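/- Let $0\le b_1<\cdots<b_g$ be finitely many integers and let $b_1^*<b_2^*<\cdots$ be the remaining non-negative integers. (The motivating case: the gaps and non-gaps at $p_\infty$ of the degree-zero line bundle $L_{e+\delta}$ on a compact Riemann surface of genus $g$, where $e$ is a zero of Riemann's theta function and $\delta$ is Riemann's constant.) Put $\lambda=(\lambda_1,\dots,\lambda_g)=(b_g,\dots,b_1)-(g-1,\dots,1,0)$, and for $0\le k\le g$ put $$m_k=\#\{i: b_i^*<g-k\},\qquad A_k=(b_{g-k},b_{g-k-1},\dots,b_{g-k-m_k+1})-(b_1^*,\dots,b_{m_k}^*),$$ a sequence of $m_k$ positive integers, and let $c_k=\pm1$ be the sign of the permutation of $\{0,\dots,g-k-1\}$ that sends the entries of $(b_1^*,\dots,b_{m_k}^*,b_{g-k-m_k},\dots,b_1)$, in this order, to $g-k-1,\dots,1,0$. For $t=(t_1,t_2,\dots)$ define $p_n(t)$ by $\exp\bigl(\sum_{n\ge1}t_nz^n\bigr)=\sum_{n\ge0}p_n(t)z^n$, $p_n=0$ for $n<0$, and $s_{(\mu_1,\dots,\mu_l)}(t)=\det(p_{\mu_i-i+j}(t))_{1\le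 i,j\le l}$ (equal to $1$ for $l=0$). For partitions write $\lambda\le\mu$ if $\lambda_i\le\mu_i$ for all $i$. Let $\xi_\mu\in\mathbb C$ be arbitrary for $\mu>\lambda$, and consider the formal power series $$\tau(t)=s_\lambda(t)+\sum_{\mu>\lambda}\xi_\mu s_\mu(t),\qquad \tau^{(k)}(t)=s_{(\lambda_1,\dots,\lambda_k)}(t)+\sum_{\mu}\xi_\mu s_{(\mu_1,\dots,\mu_k)}(t),$$ the last sum being over the partitions $\mu=(\mu_1,\dots,\mu_g)$ with $\mu>\lambda$ and $\mu_i=\lambda_i$ for $k+1\le i\le g$ (so $\tau^{(0)}=1$). Write $[x]=(x,x^2/2,x^3/3,\dots)$ and $\partial_{t,I}=\partial_{t_{i_1}}\cdots\partial_{t_{i_m}}$ for a finite sequence $I=(i_1,\dots,i_m)$ of positive integers. Below, $x_1,x_2,\dots$ are formal variables, and $F=G+O(x_k^N)$ means that $F-G$ is divisible by $x_k^N$ as a formal power series. (A) Let $0\le k\le g-1$ with $m_k>0$. Then (i) $\displaystyle\partial_{t,A_k}\tau\Bigl(\sum_{i=1}^k[x_i]\Bigr)=c_k\,\tau^{(k)}\Bigl(\sum_{i=1}^k[x_i]\Bigr)$;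 and, if $k\ge1$, (ii) $\displaystyle\tau^{(k)}\Bigl(\sum_{i=1}^k[x_i]\Bigr)=\tau^{(k-1)}\Bigl(\sum_{i=1}^{k-1}[x_i]\Bigr)x_k^{\lambda_k}+O(x_k^{\lambda_k+1})$; (iii) $\displaystyle\partial_{t,A_k}\tau\Bigl(\sum_{i=1}^k[x_i]\Bigr)=\frac{c_k}{c_{k-1}}\,\partial_{t,A_{k-1}}\tau\Bigl(\sum_{i=1}^{k-1}[x_i]\Bigr)x_k^{\lambda_k}+O(x_k^{\lambda_k+1})$. (B) (i) $\partial_{t,I}\tau(0)=0$ for every $I=(i_1,\dots,i_m)$ with $i_1+\cdots+i_m<|\lambda|=\lambda_1+\cdots+\lambda_g$. (ii) $\partial_{t,I}\tau(0)=0$ for every $I=(i_1,\dots,i_m)$ with $m<m_0$. (iii) $\partial_{t,A_0}\tau(0)=c_0$. -/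

import Mathlib

namespace GapTau

noncomputable section

/-! ### Gaps, the partition, the a-sequence and the sign

A finite set `B` of non-negative integers plays the role of the set of gaps
`b_1 < ... < b_g`, with `g = B.card`; its complement is the set of non-gaps
`b*_1 < b*_2 < ...`.  Lean indices start at `0`. -/

/-- `gap B i` is the gap `b_{i+1}`, for `i < B.card`. -/
def gap (B : Finset ℕ) (i : ℕ) : ℕ := Nat.nth (fun n => n ∈ B) i

/-- `nongap B i` is the non-gap `b*_{i+1}`. -/
def nongap (B : Finset ℕ) (i : ℕ) : ℕ := Nat.nth (fun n => n ∉ B) i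

/-- `m_k`, the number of non-gaps smaller than `g - k`. -/
def mNum (B : Finset ℕ) (k : ℕ) : ℕ := Nat.count (fun n => n ∉ B) (B.card - k)

theorem count_add_mNum (B : Finset ℕ) (k : ℕ) :
    Nat.count (fun n => n ∈ B) (B.card - k) + mNum B k = B.card - k := by
  unfold mNum
  simp only [Nat.count_eq_card_filter_range]
  simpa using Finset.card_filter_add_card_filter_not (s := Finset.range (B.card - k))
    (fun n => n ∈ B)

theorem gap_cond {B : Finset ℕ} {i : ℕ} (hi : i < B.card) :
    ∀ hf : (Set.ofPred (fun n => n ∈ B)).Finite, i < hf.toFinset.card := by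
  intro hf
  have : hf.toFinset = B := by ext n; simp
  rwa [this]

theorem nongap_infinite (B : Finset ℕ) : (Set.ofPred (fun n => n ∉ B)).Infinite :=
  B.finite_toSet.infinite_compl

theorem gap_mem {B : Finset ℕ} {i : ℕ} (hi : i < B.card) : gap B i ∈ B :=
  Nat.nth_mem i (gap_cond hi)

theorem nongap_notMem (B : Finset ℕ) (i : ℕ) : nongap B i ∉ B :=
  Nat.nth_mem_of_infinite (nongap_infinite B) i

theorem gap_lt_gap {B : Finset ℕ} {i j : ℕ} (h : i < j) (hj : j < B.card) : gap B i < gap B j :=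
  Nat.nth_lt_nth' h (gap_cond hj)

theorem nongap_lt {B : Finset ℕ} {k i : ℕ} (hi : i < mNum B k) : nongap B i < B.card - k :=
  Nat.nth_lt_of_lt_count hi

theorem gap_lt {B : Finset ℕ} {k i : ℕ} (hi : i + mNum B k < B.card - k) :
    gap B i < B.card - k := by
  have := count_add_mNum B k
  exact Nat.nth_lt_of_lt_count (by omega)

theorem le_gap {B : Finset ℕ} {k i : ℕ} (hi : B.card - k ≤ i + mNum B k) (hi' : i < B.card) :
    B.card - k ≤ gap B i := by
  by_contra h
  have h1 : Nat.count (fun n => n ∈ B) (gap B i + 1) ≤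
      Nat.count (fun n => n ∈ B) (B.card - k) := Nat.count_monotone _ (by omega)
  have h2 : Nat.count (fun n => n ∈ B) (gap B i + 1) = i + 1 := Nat.count_nth_succ (gap_cond hi')
  have := count_add_mNum B k
  omega

/-- The parts of the partition: `lamPart B i` is `λ_{i+1} = b_{g-i} - (g-1-i)` for `i < g`, and
`0` for `i ≥ g`. -/
def lamPart (B : Finset ℕ) (i : ℕ) : ℕ :=
  if i < B.card then gap B (B.card - 1 - i) - (B.card - 1 - i) else 0

theorem lamPart_antitone (B : Finset ℕ) : Antitone (lamPart B) := by
  refine antitone_nat_of_succ_le fun i => ?_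
  unfold lamPart
  split_ifs with h1 h2
  · have := gap_lt_gap (B := B) (i := B.card - 1 - (i + 1)) (j := B.card - 1 - i)
      (by omega) (by omega)
    omega
  · omega
  · omega
  · omega

/-- The partition `λ = (b_g, ..., b_1) - (g-1, ..., 1, 0)`. -/
def lam (B : Finset ℕ) : YoungDiagram where
  cells := (Finset.range B.card).biUnion fun i =>
    (Finset.range (lamPart B i)).image fun j => (i, j)
  isLowerSet := by
    rintro ⟨i, j⟩ ⟨i', j'⟩ hle h
    obtain ⟨h1, h2⟩ : i' ≤ i ∧ j' ≤ j := hle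
    simp only [Finset.mem_coe, Finset.mem_biUnion, Finset.mem_image, Finset.mem_range,
      Prod.mk.injEq] at h ⊢
    obtain ⟨a, ha, b, hb, rfl, rfl⟩ := h
    exact ⟨i', by omega, j', by have := lamPart_antitone B h1; omega, rfl, rfl⟩

theorem rowLen_lam (B : Finset ℕ) (i : ℕ) : (lam B).rowLen i = lamPart B i := by
  have key : ∀ j, j < (lam B).rowLen i ↔ j < lamPart B i := by
    intro j
    rw [← YoungDiagram.mem_iff_lt_rowLen, ← YoungDiagram.mem_cells]
    simp only [lam, Finset.mem_biUnion, Finset.mem_image, Finset.mem_range, Prod.mk.injEq]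
    constructor
    · rintro ⟨a, ha, b, hb, rfl, rfl⟩
      exact hb
    · intro hj
      refine ⟨i, ?_, j, hj, rfl, rfl⟩
      by_contra hi
      simp [lamPart, hi] at hj
  exact le_antisymm (not_lt.1 fun h => lt_irrefl _ ((key _).1 h))
    (not_lt.1 fun h => lt_irrefl _ ((key _).2 h))

theorem aSeq_pos {B : Finset ℕ} {k i : ℕ} (hi : i < mNum B k) :
    0 < gap B (B.card - k - 1 - i) - nongap B i := by
  have h1 := nongap_lt hi
  have h2 := count_add_mNum B k
  have h3 := le_gap (B := B) (k := k) (i := B.card - k - 1 - i) (by omega) (by omega)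
  omega

/-- The a-sequence `A_k = (b_{g-k}, ..., b_{g-k-m_k+1}) - (b*_1, ..., b*_{m_k})`, a list of
positive integers of length `m_k`. -/
def aSeq (B : Finset ℕ) (k : ℕ) : List ℕ+ :=
  List.ofFn fun i : Fin (mNum B k) => ⟨gap B (B.card - k - 1 - i) - nongap B i, aSeq_pos i.2⟩

/-- The sequence `(b*_1, ..., b*_{m_k}, b_{g-k-m_k}, ..., b_1)` of length `g - k`. -/
def topRow (B : Finset ℕ) (k : ℕ) (j : ℕ) : ℕ :=
  if j < mNum B k then nongap B j else gap B (B.card - k - 1 - j)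

theorem topRow_lt {B : Finset ℕ} {k j : ℕ} (hj : j < B.card - k) : topRow B k j < B.card - k := by
  unfold topRow
  split_ifs with h
  · exact nongap_lt h
  · exact gap_lt (by omega)

theorem topRow_injective (B : Finset ℕ) (k : ℕ) :
    Function.Injective fun j : Fin (B.card - k) =>
      (⟨topRow B k j, topRow_lt j.2⟩ : Fin (B.card - k)) := by
  rintro ⟨i, hi⟩ ⟨j, hj⟩ h
  simp only [Fin.mk.injEq] at h ⊢
  unfold topRow at h
  split_ifs at h with h1 h2 h2
  · exact Nat.nth_injective (nongap_infinite B) h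
  · exact absurd (h ▸ gap_mem (by omega)) (nongap_notMem B i)
  · exact absurd (h.symm ▸ gap_mem (by omega)) (nongap_notMem B j)
  · rcases lt_trichotomy i j with hij | hij | hij
    · have := gap_lt_gap (B := B) (i := B.card - k - 1 - j) (j := B.card - k - 1 - i)
        (by omega) (by omega)
      omega
    · exact hij
    · have := gap_lt_gap (B := B) (i := B.card - k - 1 - i) (j := B.card - k - 1 - j)
        (by omega) (by omega)
      omega

/-- `topRow` as a bijection from positions to values in `{0, ..., g-k-1}`. -/
def topRowEquiv (B : Finset ℕ) (k : ℕ) : Equiv.Perm (Fin (B.card - k)) :=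
  Equiv.ofBijective _ (Finite.injective_iff_bijective.1 (topRow_injective B k))

/-- The sign `c_k` of the permutation of `{0, ..., g-k-1}` which sends the entries of
`(b*_1, ..., b*_{m_k}, b_{g-k-m_k}, ..., b_1)`, in this order, to `g-k-1, ..., 1, 0`. -/
def cSign (B : Finset ℕ) (k : ℕ) : ℤˣ :=
  Equiv.Perm.sign ((topRowEquiv B k).symm.trans Fin.revPerm)

/-! ### Schur functions

The variable `t_n`, `n ≥ 1`, is `MvPolynomial.X n` with `n : ℕ+`. -/

/-- The series `∑_{n ≥ 1} t_n z^n` in `z`. -/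
def tSeries : PowerSeries (MvPolynomial ℕ+ ℂ) :=
  PowerSeries.mk fun n => if h : 0 < n then MvPolynomial.X ⟨n, h⟩ else 0

/-- `p_n(t)`, the coefficient of `z^n` in `exp (∑_{n ≥ 1} t_n z^n)`, and `0` for `n < 0`. -/
def pPoly (n : ℤ) : MvPolynomial ℕ+ ℂ :=
  if 0 ≤ n then
    PowerSeries.coeff n.toNat ((PowerSeries.exp (MvPolynomial ℕ+ ℂ)).subst tSeries)
  else 0

/-- The determinant `det (p_{f_i - i + j})_{1 ≤ i, j ≤ l}` for the sequence
`(f_1, ..., f_l) = (f 0, ..., f (l-1))`; it is `1` for `l = 0`. -/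
def schurSeq (l : ℕ) (f : ℕ → ℕ) : MvPolynomial ℕ+ ℂ :=
  Matrix.det (Matrix.of fun i j : Fin l => pPoly ((f i : ℤ) - (i : ℤ) + (j : ℤ)))

/-- The Schur function `s_μ(t)`; `μ.rowLen i` is `μ_{i+1}` and `μ.colLen 0` is the length. -/
def schur (μ : YoungDiagram) : MvPolynomial ℕ+ ℂ := schurSeq (μ.colLen 0) μ.rowLen

/-! ### The series `τ` and `τ^{(k)}` -/

/-- The formal power series `∑_{μ : P μ} ξ_μ s_μ`, summed coefficientwise.  It is used only where
each coefficient involves finitely many `μ` (`schur_coeff_finite`, `schurSeq_coeff_finite`). -/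
def formalSum (P : YoungDiagram → Prop) (ξ : YoungDiagram → ℂ)
    (s : YoungDiagram → MvPolynomial ℕ+ ℂ) : MvPowerSeries ℕ+ ℂ :=
  fun d => ∑ᶠ (μ : YoungDiagram) (_ : P μ), ξ μ * MvPolynomial.coeff d (s μ)

/-- The formal power series `τ = s_λ + ∑_{μ > λ} ξ_μ s_μ`, where `λ < μ` is strict inclusion of
diagrams. -/
def tau (B : Finset ℕ) (ξ : YoungDiagram → ℂ) : MvPowerSeries ℕ+ ℂ :=
  (schur (lam B) : MvPowerSeries ℕ+ ℂ) + formalSum (fun μ => lam B < μ) ξ schur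

/-- The partition `μ` has at most `g` parts and `μ_i = λ_i` for `k+1 ≤ i ≤ g`. -/
def SameTail (B : Finset ℕ) (k : ℕ) (μ : YoungDiagram) : Prop :=
  μ.colLen 0 ≤ B.card ∧ ∀ i, k ≤ i → i < B.card → μ.rowLen i = (lam B).rowLen i

/-- The formal power series `τ^{(k)} = s_{(λ_1, ..., λ_k)} + ∑_μ ξ_μ s_{(μ_1, ..., μ_k)}`, the sum
being over the `μ > λ` with `SameTail B k μ`.  For `k = 0` the sum is empty and the series
is `1`. -/
def tauTrunc (B : Finset ℕ) (ξ : YoungDiagram → ℂ) (k : ℕ) : MvPowerSeries ℕ+ ℂ :=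
  (schurSeq k (lam B).rowLen : MvPowerSeries ℕ+ ℂ) +
    formalSum (fun μ => lam B < μ ∧ SameTail B k μ) ξ fun μ => schurSeq k μ.rowLen

/-- `∂_{t,I} = ∂_{t_{i_1}} ⋯ ∂_{t_{i_r}}` for `I = (i_1, ..., i_r)`. -/
def dList (I : List ℕ+) (f : MvPowerSeries ℕ+ ℂ) : MvPowerSeries ℕ+ ℂ :=
  I.foldr (fun i h => MvPowerSeries.pderiv ℂ i h) f

/-! ### Evaluation at `[x_1] + ... + [x_k]` -/

/-- The point `∑_{i=1}^k [x_i]`: its `n`-th coordinate is `∑_{i=1}^k x_i^n / n`, a polynomial in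
formal variables, `MvPowerSeries.X i` being `x_{i+1}`. -/
def xPoint (k : ℕ) (n : ℕ+) : MvPowerSeries ℕ ℂ :=
  ∑ i ∈ Finset.range k, ((n : ℂ)⁻¹) • (MvPowerSeries.X i) ^ (n : ℕ)

/-- The value `f (∑_{i=1}^k [x_i])`, a formal power series in the `x_i`. -/
def evalX (k : ℕ) (f : MvPowerSeries ℕ+ ℂ) : MvPowerSeries ℕ ℂ :=
  MvPowerSeries.subst (xPoint k) f

/-- `F = G + O(x_k^N)` (for `k ≥ 1`) for formal power series: `F - G` is divisible by `x_k^N`. -/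
def EqModX (k N : ℕ) (F G : MvPowerSeries ℕ ℂ) : Prop :=
  (MvPowerSeries.X (k - 1) : MvPowerSeries ℕ ℂ) ^ N ∣ F - G

/-! ### The formal sums and substitutions above are meaningful -/

theorem hasSubst_tSeries : PowerSeries.HasSubst tSeries :=
  PowerSeries.HasSubst.of_constantCoeff_zero' (by simp [tSeries])

theorem hasSubst_xPoint (k : ℕ) : MvPowerSeries.HasSubst (xPoint k) where
  const_coeff n := by simp [xPoint]
  coeff_zero d := by
    classical
    have hinj : Function.Injective ((fun n : ℕ+ => (n : ℕ))) := PNat.coe_injective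
    refine Set.Finite.subset (Set.Finite.preimage hinj.injOn (Set.finite_singleton d.degree)) ?_
    intro n hn
    simp only [Set.mem_preimage, Set.mem_singleton_iff]
    by_contra hne
    apply hn
    simp only [xPoint, map_sum, MvPowerSeries.coeff_smul]
    refine Finset.sum_eq_zero fun i _ => ?_
    rw [MvPowerSeries.coeff_X_pow, if_neg]
    · simp
    · rintro rfl
      exact hne (by simp)

theorem coeff_tSeries_pow_isWeightedHomogeneous (j n : ℕ) :
    MvPolynomial.IsWeightedHomogeneous (fun i : ℕ+ => (i : ℕ))
      (PowerSeries.coeff n (tSeries ^ j)) n := by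
  induction j generalizing n with
  | zero =>
    rw [pow_zero, PowerSeries.coeff_one]
    split_ifs with h
    · subst h; exact MvPolynomial.isWeightedHomogeneous_one _ _
    · exact MvPolynomial.isWeightedHomogeneous_zero _ _ _
  | succ j ih =>
    rw [pow_succ, PowerSeries.coeff_mul]
    refine MvPolynomial.IsWeightedHomogeneous.sum _ _ _ fun x hx => ?_
    rw [← Finset.HasAntidiagonal.mem_antidiagonal.1 hx]
    refine (ih x.1).mul ?_
    simp only [tSeries, PowerSeries.coeff_mk]
    split_ifs with h
    · exact MvPolynomial.isWeightedHomogeneous_X ℂ (fun i : ℕ+ => (i : ℕ)) ⟨x.2, h⟩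
    · exact MvPolynomial.isWeightedHomogeneous_zero _ _ _

theorem pPoly_isWeightedHomogeneous (n : ℕ) :
    MvPolynomial.IsWeightedHomogeneous (fun i : ℕ+ => (i : ℕ)) (pPoly n) n := by
  simp only [pPoly, Int.natCast_nonneg, if_true, Int.toNat_natCast]
  rw [PowerSeries.coeff_subst' hasSubst_tSeries,
    finsum_eq_sum _ (PowerSeries.coeff_subst_finite' hasSubst_tSeries _ _)]
  refine MvPolynomial.IsWeightedHomogeneous.sum _ _ _ fun j _ => ?_
  rw [PowerSeries.coeff_exp, smul_eq_mul, IsScalarTower.algebraMap_apply ℚ ℂ (MvPolynomial ℕ+ ℂ)]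
  exact (coeff_tSeries_pow_isWeightedHomogeneous j n).C_mul _

/-- The determinant is weight-homogeneous of weight `f_1 + ... + f_l`. -/
theorem schurSeq_isWeightedHomogeneous (l : ℕ) (f : ℕ → ℕ) :
    MvPolynomial.IsWeightedHomogeneous (fun i : ℕ+ => (i : ℕ)) (schurSeq l f)
      (∑ i : Fin l, f i) := by
  unfold schurSeq
  rw [Matrix.det_apply]
  refine MvPolynomial.IsWeightedHomogeneous.sum _ _ _ fun σ _ => ?_
  have key : MvPolynomial.IsWeightedHomogeneous (fun i : ℕ+ => (i : ℕ))
      (∏ i : Fin l, pPoly ((f (σ i) : ℤ) - ((σ i : ℕ) : ℤ) + ((i : ℕ) : ℤ)))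
      (∑ i : Fin l, f i) := by
    by_cases h : ∀ i : Fin l, 0 ≤ (f (σ i) : ℤ) - ((σ i : ℕ) : ℤ) + ((i : ℕ) : ℤ)
    · choose e he using fun i => Int.eq_ofNat_of_zero_le (h i)
      have hs : ∑ i : Fin l, f i = ∑ i, e i := by
        zify
        simp only [← he, Finset.sum_add_distrib, Finset.sum_sub_distrib]
        rw [Equiv.sum_comp σ (fun i : Fin l => (f i : ℤ)),
          Equiv.sum_comp σ (fun i : Fin l => ((i : ℕ) : ℤ))]
        ring
      rw [hs]
      refine MvPolynomial.IsWeightedHomogeneous.prod _ _ _ fun i _ => ?_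
      rw [he]
      exact pPoly_isWeightedHomogeneous _
    · push Not at h
      obtain ⟨i, hi⟩ := h
      rw [Finset.prod_eq_zero (Finset.mem_univ i)]
      · exact MvPolynomial.isWeightedHomogeneous_zero _ _ _
      · rw [pPoly, if_neg (not_le.2 hi)]
  have hm := (MvPolynomial.mem_weightedHomogeneousSubmodule ℂ _ _ _).2 key
  rw [← MvPolynomial.mem_weightedHomogeneousSubmodule] at *
  rcases Int.units_eq_one_or (Equiv.Perm.sign σ) with h | h
  · rw [h, one_smul]; exact hm
  · rw [h, Units.neg_smul, one_smul]; exact Submodule.neg_mem _ hm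

theorem finite_of_cells_subset (S : Finset (ℕ × ℕ)) :
    {μ : YoungDiagram | μ.cells ⊆ S}.Finite := by
  have hinj : Function.Injective YoungDiagram.cells := fun μ ν h => YoungDiagram.ext h
  refine Set.Finite.subset
    (Set.Finite.preimage hinj.injOn (S.powerset.finite_toSet)) fun μ hμ => ?_
  simpa using hμ

/-- Only finitely many Schur functions contain a given monomial. -/
theorem schur_coeff_finite (d : ℕ+ →₀ ℕ) :
    {μ : YoungDiagram | MvPolynomial.coeff d (schur μ) ≠ 0}.Finite := by
  set N := Finsupp.weight (fun i : ℕ+ => (i : ℕ)) d with hN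
  refine (finite_of_cells_subset (Finset.range N ×ˢ Finset.range N)).subset fun μ hμ => ?_
  have hw : N = ∑ i : Fin (μ.colLen 0), μ.rowLen i :=
    schurSeq_isWeightedHomogeneous _ _ hμ
  have hlen : μ.colLen 0 ≤ N := by
    rw [hw]
    calc μ.colLen 0 = ∑ _i : Fin (μ.colLen 0), 1 := by simp
      _ ≤ _ := Finset.sum_le_sum fun i _ => by
        have : ((i : ℕ), 0) ∈ μ := YoungDiagram.mem_iff_lt_colLen.2 i.2
        have := YoungDiagram.mem_iff_lt_rowLen.1 this
        omega
  rintro ⟨i, j⟩ hij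
  rw [YoungDiagram.mem_cells] at hij
  have hi : i < μ.colLen 0 :=
    YoungDiagram.mem_iff_lt_colLen.1 (μ.up_left_mem le_rfl (Nat.zero_le j) hij)
  have hj := YoungDiagram.mem_iff_lt_rowLen.1 hij
  have hrow : μ.rowLen i ≤ N := by
    rw [hw]
    exact Finset.single_le_sum (f := fun i : Fin (μ.colLen 0) => μ.rowLen i)
      (fun _ _ => Nat.zero_le _) (Finset.mem_univ ⟨i, hi⟩)
  simp only [Finset.mem_product, Finset.mem_range]
  omega

/-- Only finitely many of the `s_{(μ_1, ..., μ_k)}` in `τ^{(k)}` contain a given monomial. -/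
theorem schurSeq_coeff_finite (B : Finset ℕ) (k : ℕ) (d : ℕ+ →₀ ℕ) :
    {μ : YoungDiagram | SameTail B k μ ∧
      MvPolynomial.coeff d (schurSeq k μ.rowLen) ≠ 0}.Finite := by
  set N := Finsupp.weight (fun i : ℕ+ => (i : ℕ)) d with hN
  refine (finite_of_cells_subset
    (Finset.range k ×ˢ Finset.range N ∪ (lam B).cells)).subset fun μ hμ => ?_
  obtain ⟨⟨h1, h2⟩, h3⟩ := hμ
  have hw : N = ∑ i : Fin k, μ.rowLen i := schurSeq_isWeightedHomogeneous _ _ h3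
  rintro ⟨i, j⟩ hij
  rw [YoungDiagram.mem_cells] at hij
  have hi : i < μ.colLen 0 :=
    YoungDiagram.mem_iff_lt_colLen.1 (μ.up_left_mem le_rfl (Nat.zero_le j) hij)
  have hj := YoungDiagram.mem_iff_lt_rowLen.1 hij
  simp only [Finset.mem_union, Finset.mem_product, Finset.mem_range]
  by_cases hik : i < k
  · left
    have hrow : μ.rowLen i ≤ N := by
      rw [hw]
      exact Finset.single_le_sum (f := fun i : Fin k => μ.rowLen i)
        (fun _ _ => Nat.zero_le _) (Finset.mem_univ ⟨i, hik⟩)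
    omega
  · right
    rw [YoungDiagram.mem_cells, YoungDiagram.mem_iff_lt_rowLen, ← h2 i (by omega) (by omega)]
    exact hj

end

end GapTau

/-!
At `[x_1] + ⋯ + [x_k]` the series `∑ p_n z^n` becomes `H(z) = ∏ (1 - x_i z)⁻¹`, and `∂_{t_i}`
multiplies `∑ p_n z^n` by `z^i`. A derivative `∂_{t,A_k}` of a Jacobi–Trudi determinant is therefore
a sum, over all ways of assigning the entries of `A_k` to rows, of Jacobi–Trudi determinants with
the row indices lowered accordingly. Convolving the columns of index `≥ k` with `∏ (1 - x_i z)`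
turns them into columns of a matrix of zeros and ones, so a term survives only if the lowered
indices of some rows fill out `-k, -(k+1), …`. As `|A_k| = λ_{k+1} + ⋯ + λ_g`, for `μ ≥ λ` this
forces `μ_i = λ_i` for `i > k`, and then, by the equality case of the rearrangement inequality, the
assignment which lowers row `k + j` by the `j`-th entry of `A_k`. The surviving determinant is block
triangular, with diagonal blocks the Jacobi–Trudi matrix of `(μ_1, …, μ_k)` and a permutation matrix
of sign `c_k`. For (A)(ii), convolving with only `∏_{i<k} (1 - x_i z)` makes the last column a
column of powers of `x_k`, whose lowest power is the cofactor of the previous Schur function. The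
vanishing in (B)(i) is a count of weights, and in (B)(ii) it holds because an `n × n` square inside
`λ` needs every one of its `n` rows to be lowered.
-/

namespace GapTau

noncomputable section

section PowerSeries

open PowerSeries

variable {R : Type*} [CommRing R]

theorem eq_zero_of_derivative_eq_mul [Algebra ℚ R] {F P : R⟦X⟧}
    (hF : d⁄dX R F = F * P) (h0 : constantCoeff F = 0) : F = 0 := by
  ext n
  induction n using Nat.strong_induction_on with
  | _ n ih =>
    rcases n with _ | n
    · simpa using h0
    · have hn := congrArg (coeff n) hF
      have hsum : coeff n (F * P) = 0 := by
        rw [coeff_mul]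
        refine Finset.sum_eq_zero fun x hx => ?_
        have := Finset.HasAntidiagonal.mem_antidiagonal.1 hx
        rw [ih x.1 (by omega), map_zero, zero_mul]
      have hunit : IsUnit ((n : R) + 1) := by
        simpa using (IsUnit.mk0 ((n : ℚ) + 1) n.cast_add_one_ne_zero).map (algebraMap ℚ R)
      rw [coeff_derivative, hsum, hunit.mul_left_eq_zero] at hn
      rw [hn, map_zero]

/-- The derivation of `R⟦X⟧` which applies a derivation of `R` to each coefficient. -/
def coeffwise {S : Type*} [CommRing S] [Algebra S R] (D : Derivation S R R) :
    Derivation S R⟦X⟧ R⟦X⟧ :=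
  Derivation.mk'
    { toFun := fun F => mk fun n => D (coeff n F)
      map_add' := fun F G => by ext; simp
      map_smul' := fun c F => by ext; simp }
    fun F G => by
      ext n
      simp only [LinearMap.coe_mk, AddHom.coe_mk, smul_eq_mul, mul_comm G, coeff_mk, map_add,
        coeff_mul, map_sum, Derivation.leibniz, Finset.sum_add_distrib]
      simp only [mul_comm]

section Coeffwise

variable {S : Type*} [CommRing S] [Algebra S R] (D : Derivation S R R)

@[simp]
theorem coeff_coeffwise (n : ℕ) (F : R⟦X⟧) : coeff n (coeffwise D F) = D (coeff n F) :=
  coeff_mk n fun n => D (coeff n F)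

theorem coeffwise_derivative (F : R⟦X⟧) : coeffwise D (d⁄dX R F) = d⁄dX R (coeffwise D F) := by
  ext n
  have hn : D ((n : R) + 1) = 0 := by simp
  rw [coeff_coeffwise, coeff_derivative, coeff_derivative, coeff_coeffwise, D.leibniz, hn,
    smul_zero, zero_add, smul_eq_mul, mul_comm]

end Coeffwise

theorem constantCoeff_exp_subst [Algebra ℚ R] {G : R⟦X⟧} (hG : constantCoeff G = 0) :
    constantCoeff ((exp R).subst G) = 1 := by
  rw [← coeff_zero_eq_constantCoeff_apply, coeff_subst' (.of_constantCoeff_zero' hG),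
    finsum_eq_single _ 0 fun n hn => by simp [hG, hn]]
  simp

theorem derivative_exp_subst [Algebra ℚ R] {G : R⟦X⟧} (hG : constantCoeff G = 0) :
    d⁄dX R ((exp R).subst G) = (exp R).subst G * d⁄dX R G := by
  rw [derivative_subst (.of_constantCoeff_zero' hG), derivative_exp]

/-- Both sides `H` of the identity satisfy `H' - H G' = exp(G) D(G')`. -/
theorem coeffwise_exp_subst [Algebra ℚ R] {S : Type*} [CommRing S] [Algebra S R]
    (D : Derivation S R R) {G : R⟦X⟧} (hG : constantCoeff G = 0) :
    coeffwise D ((exp R).subst G) = (exp R).subst G * coeffwise D G := by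
  rw [← sub_eq_zero]
  refine eq_zero_of_derivative_eq_mul (P := d⁄dX R G) ?_ ?_
  · rw [map_sub, ← coeffwise_derivative, Derivation.leibniz, ← coeffwise_derivative,
      derivative_exp_subst hG, Derivation.leibniz]
    simp only [smul_eq_mul]
    ring
  · rw [map_sub, map_mul, constantCoeff_exp_subst hG]
    simp only [← coeff_zero_eq_constantCoeff_apply, coeff_coeffwise]
    simp only [coeff_zero_eq_constantCoeff_apply, constantCoeff_exp_subst hG, hG]
    simp

theorem mk_pow_mul_one_sub (x : R) : mk (fun n => x ^ n) * (1 - C x * X) = 1 := by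
  ext n
  rw [mul_sub, mul_one, map_sub, ← mul_assoc, coeff_mk]
  cases n with
  | zero => simp
  | succ n => simp [coeff_one, pow_succ]

/-- The coefficient of a power series at an integer exponent, zero at a negative one. -/
def intCoeff (n : ℤ) : R⟦X⟧ →ₗ[R] R := if 0 ≤ n then coeff n.toNat else 0

@[simp]
theorem intCoeff_natCast (n : ℕ) (F : R⟦X⟧) : intCoeff (n : ℤ) F = coeff n F := by
  simp [intCoeff]

theorem intCoeff_of_neg {n : ℤ} (hn : n < 0) (F : R⟦X⟧) : intCoeff n F = 0 := by
  simp [intCoeff, hn.not_ge]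

theorem intCoeff_map {S : Type*} [CommRing S] (f : R →+* S) (n : ℤ) (F : R⟦X⟧) :
    intCoeff n (F.map f) = f (intCoeff n F) := by
  by_cases hn : 0 ≤ n <;> simp [intCoeff, hn]

theorem intCoeff_coeffwise {S : Type*} [CommRing S] [Algebra S R] (D : Derivation S R R) (n : ℤ)
    (F : R⟦X⟧) : intCoeff n (coeffwise D F) = D (intCoeff n F) := by
  by_cases hn : 0 ≤ n <;> simp [intCoeff, hn]

theorem intCoeff_mul_X_pow (n : ℤ) (F : R⟦X⟧) (m : ℕ) :
    intCoeff n (F * X ^ m) = intCoeff (n - m) F := by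
  rcases lt_or_ge n 0 with hn | hn
  · rw [intCoeff_of_neg hn, intCoeff_of_neg (by omega)]
  lift n to ℕ using hn
  rw [intCoeff_natCast, coeff_mul_X_pow']
  split_ifs with hm
  · rw [← Nat.cast_sub hm, intCoeff_natCast]
  · rw [intCoeff_of_neg (by omega)]

theorem intCoeff_mul_coe {k : ℕ} {G : Polynomial R} (hG : G.natDegree ≤ k) (n : ℤ) (F : R⟦X⟧) :
    intCoeff n (F * (G : R⟦X⟧)) =
      ∑ l ∈ Finset.range (k + 1), intCoeff (n - (l : ℕ)) F * G.coeff l := by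
  have hsum : F * (G : R⟦X⟧) = ∑ l ∈ Finset.range (k + 1), G.coeff l • (F * X ^ l) := by
    conv_lhs => rw [G.as_sum_range_C_mul_X_pow' (Nat.lt_succ_of_le hG)]
    rw [← Polynomial.coeToPowerSeries.ringHom_apply, map_sum, Finset.mul_sum]
    refine Finset.sum_congr rfl fun l _ => ?_
    simp only [Polynomial.coeToPowerSeries.ringHom_apply, Polynomial.coe_mul, Polynomial.coe_C,
      Polynomial.coe_pow, Polynomial.coe_X, smul_eq_C_mul]
    ring
  simp only [hsum, map_sum, map_smul, intCoeff_mul_X_pow, smul_eq_mul, mul_comm]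

end PowerSeries

section Derivation

variable {n S A : Type*} [DecidableEq n] [CommRing S] [CommRing A] [Algebra S A]
  (D : Derivation S A A)

theorem derivation_prod (s : Finset n) (f : n → A) :
    D (∏ i ∈ s, f i) = ∑ r ∈ s, ∏ i ∈ s, Function.update f r (D (f r)) i := by
  induction s using Finset.induction_on with
  | empty => simp
  | insert a s ha ih =>
    rw [Finset.prod_insert ha, D.leibniz, ih, Finset.sum_insert ha, Finset.prod_insert ha,
      Function.update_self, smul_eq_mul, smul_eq_mul, Finset.mul_sum, add_comm, mul_comm]
    congr 1
    · congr 1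
      refine Finset.prod_congr rfl fun i hi => ?_
      rw [Function.update_of_ne (ne_of_mem_of_not_mem hi ha)]
    · refine Finset.sum_congr rfl fun r hr => ?_
      rw [Finset.prod_insert ha, Function.update_of_ne (ne_of_mem_of_not_mem hr ha).symm]

theorem derivation_det [Fintype n] (M : Matrix n n A) :
    D M.det = ∑ r, (M.updateRow r fun j => D (M r j)).det := by
  simp only [Matrix.det_apply]
  rw [map_sum, Finset.sum_comm]
  refine Finset.sum_congr rfl fun σ _ => ?_
  rw [← Finset.smul_sum, Units.smul_def, Units.smul_def, map_zsmul, derivation_prod,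
    ← Equiv.sum_comp σ fun r => ∏ i, M.updateRow r (fun j => D (M r j)) (σ i) i]
  congr 1
  refine Finset.sum_congr rfl fun r _ => Finset.prod_congr rfl fun i _ => ?_
  rcases eq_or_ne i r with rfl | h
  · simp
  · rw [Function.update_of_ne h, Matrix.updateRow_ne (σ.injective.ne h)]

end Derivation

section JacobiTrudi

open PowerSeries

variable {R : Type*} [CommRing R] {N : ℕ}

/-- The Jacobi–Trudi type determinant `det (h_{b_i + j})`, `0 ≤ j < N`, of the coefficients of
`F = ∑ h_n z^n`. The partition `μ` corresponds to `b_i = μ_i - i`, rows being counted from `0`. -/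
def jacobiTrudi (F : R⟦X⟧) (b : Fin N → ℤ) : R :=
  Matrix.det (Matrix.of fun i j : Fin N => intCoeff (b i + (j : ℕ)) F)

theorem jacobiTrudi_map {S : Type*} [CommRing S] (f : R →+* S) (F : R⟦X⟧) (b : Fin N → ℤ) :
    jacobiTrudi (F.map f) b = f (jacobiTrudi F b) := by
  simp only [jacobiTrudi, intCoeff_map, RingHom.map_det]
  rfl

theorem derivation_jacobiTrudi {S : Type*} [CommRing S] [Algebra S R] {D : Derivation S R R}
    {F : R⟦X⟧} {m : ℕ} (hF : coeffwise D F = F * X ^ m) (b : Fin N → ℤ) :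
    D (jacobiTrudi F b) = ∑ r, jacobiTrudi F (b - Pi.single r (m : ℤ)) := by
  rw [jacobiTrudi, derivation_det]
  refine Finset.sum_congr rfl fun r _ => congrArg Matrix.det ?_
  ext i j
  rcases eq_or_ne i r with rfl | h
  · simp only [Matrix.updateRow_self, Matrix.of_apply, ← intCoeff_coeffwise, hF,
      intCoeff_mul_X_pow, Pi.sub_apply, Pi.single_eq_same, add_sub_right_comm]
  · simp [Matrix.updateRow_ne h, Pi.single_eq_of_ne h]

/-- The matrix of the column operations which replace every column of index at least `k` by its
convolution with `G`. -/
def columnConvolution (N k : ℕ) (G : Polynomial R) : Matrix (Fin N) (Fin N) R :=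
  Matrix.of fun l j =>
    if (j : ℕ) < k then (if l = j then 1 else 0)
    else if (l : ℕ) ≤ j then G.coeff (j - l) else 0

theorem det_columnConvolution (k : ℕ) {G : Polynomial R} (h0 : G.coeff 0 = 1) :
    (columnConvolution N k G).det = 1 := by
  rw [Matrix.det_of_isUpperTriangular]
  · exact Finset.prod_eq_one fun i _ => by simp [columnConvolution, h0]
  · intro i j (hji : j < i)
    rw [columnConvolution, Matrix.of_apply, if_neg hji.ne', if_neg (Fin.lt_def.1 hji).not_ge,
      ite_self]

theorem jacobiTrudi_eq_det_convolution {k : ℕ} {G : Polynomial R} (hdeg : G.natDegree ≤ k)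
    (h0 : G.coeff 0 = 1) (F : R⟦X⟧) (b : Fin N → ℤ) :
    jacobiTrudi F b = Matrix.det (Matrix.of fun i j : Fin N =>
      intCoeff (b i + (j : ℕ)) (if (j : ℕ) < k then F else F * (G : R⟦X⟧))) := by
  rw [jacobiTrudi, ← mul_one (Matrix.det _), ← det_columnConvolution k h0, ← Matrix.det_mul]
  congr 1
  ext i j
  rw [Matrix.mul_apply]
  simp only [columnConvolution, Matrix.of_apply]
  split_ifs with hj
  · simp
  rw [intCoeff_mul_coe (hdeg.trans (not_lt.1 hj))]
  simp only [mul_ite, mul_zero]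
  rw [Fin.sum_univ_eq_sum_range (fun l : ℕ =>
    if l ≤ (j : ℕ) then intCoeff (b i + l) F * G.coeff (j - l) else 0), ← Finset.sum_filter]
  have hfilter : (Finset.range N).filter (· ≤ (j : ℕ)) = Finset.range (j + 1) := by
    ext l
    simp only [Finset.mem_filter, Finset.mem_range]
    omega
  rw [hfilter, ← Finset.sum_range_reflect]
  refine Finset.sum_congr rfl fun l hl => ?_
  have hl := Finset.mem_range.1 hl
  rw [show (j : ℕ) - (j + 1 - 1 - l) = l by omega, Nat.add_sub_cancel, Nat.cast_sub (by omega),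
    add_sub_assoc]

theorem intCoeff_one (n : ℤ) : intCoeff n (1 : R⟦X⟧) = if n = 0 then 1 else 0 := by
  rcases lt_or_ge n 0 with hn | hn
  · rw [intCoeff_of_neg hn, if_neg hn.ne]
  · lift n to ℕ using hn
    simp [coeff_one]

section PolynomialInverse

variable {k : ℕ} {F : R⟦X⟧} {G : Polynomial R} (hdeg : G.natDegree ≤ k) (h0 : G.coeff 0 = 1)
  (hFG : F * (G : R⟦X⟧) = 1)

include hdeg h0 hFG

theorem jacobiTrudi_eq_det_ite (b : Fin N → ℤ) :
    jacobiTrudi F b = Matrix.det (Matrix.of fun i j : Fin N =>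
      if (j : ℕ) < k then intCoeff (b i + (j : ℕ)) F else if b i + (j : ℕ) = 0 then 1 else 0) := by
  rw [jacobiTrudi_eq_det_convolution hdeg h0, hFG]
  congr 1
  ext i j
  simp only [Matrix.of_apply]
  split_ifs with hj <;> simp [intCoeff_one, *]

theorem exists_perm_of_jacobiTrudi_ne_zero {b : Fin N → ℤ} (h : jacobiTrudi F b ≠ 0) :
    ∃ σ : Equiv.Perm (Fin N), ∀ j : Fin N, k ≤ j → b (σ j) = -((j : ℕ) : ℤ) := by
  rw [jacobiTrudi_eq_det_ite hdeg h0 hFG, Matrix.det_apply] at h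
  obtain ⟨σ, -, hσ⟩ := Finset.exists_ne_zero_of_sum_ne_zero h
  refine ⟨σ, fun j hj => ?_⟩
  by_contra hne
  refine hσ ?_
  rw [Finset.prod_eq_zero (Finset.mem_univ j), smul_zero]
  rw [Matrix.of_apply, if_neg (by omega), if_neg (by omega)]

theorem jacobiTrudi_eq_sign_smul {r : ℕ} (hN : k + r = N) (b : Fin N → ℤ)
    (π : Equiv.Perm (Fin r))
    (hb : ∀ l : Fin r, b ⟨k + l, by omega⟩ = -((k + (π l : ℕ) : ℕ) : ℤ)) :
    jacobiTrudi F b = Equiv.Perm.sign π • jacobiTrudi F fun i : Fin k => b ⟨i, by omega⟩ := by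
  subst hN
  replace hb : ∀ l : Fin r, b (Fin.natAdd k l) = -((k + (π l : ℕ) : ℕ) : ℤ) := hb
  have hblocks : (Matrix.of fun i j : Fin (k + r) => if (j : ℕ) < k then
        intCoeff (b i + (j : ℕ)) F else if b i + (j : ℕ) = 0 then 1 else 0).submatrix
          finSumFinEquiv finSumFinEquiv =
      Matrix.fromBlocks
        (Matrix.of fun i j : Fin k => intCoeff (b (Fin.castAdd r i) + (j : ℕ)) F)
        (Matrix.of fun (i : Fin k) (j : Fin r) =>
          if b (Fin.castAdd r i) + ((k + j : ℕ) : ℤ) = 0 then 1 else 0)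
        0 π.toPEquiv.toMatrix := by
    ext (i | i) (j | j)
    · simp
    · simp
    · have : b (Fin.natAdd k i) + (j : ℕ) < 0 := by rw [hb]; omega
      simp [intCoeff_of_neg this]
    · have : b (Fin.natAdd k i) + ((k + j : ℕ) : ℤ) = 0 ↔ π i = j := by
        rw [hb, Fin.ext_iff]; omega
      simp [PEquiv.toMatrix_apply, ← this]
  rw [jacobiTrudi_eq_det_ite hdeg h0 hFG, ← Matrix.det_submatrix_equiv_self finSumFinEquiv, hblocks,
    Matrix.det_fromBlocks_zero₂₁, Matrix.det_permutation, mul_comm, Units.smul_def, zsmul_eq_mul]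
  rfl

end PolynomialInverse

end JacobiTrudi

section Specialization

open PowerSeries

/-- The generating series `∑ p_n z^n = exp (∑ t_n z^n)`. -/
def pSeries : (MvPolynomial ℕ+ ℂ)⟦X⟧ := (exp (MvPolynomial ℕ+ ℂ)).subst tSeries

theorem pPoly_eq_intCoeff (n : ℤ) : pPoly n = intCoeff n pSeries := by
  by_cases hn : 0 ≤ n <;> simp [pPoly, intCoeff, pSeries, hn]

theorem constantCoeff_tSeries : constantCoeff tSeries = 0 := by
  simp [tSeries]

theorem coeff_succ_tSeries (n : ℕ) : coeff (n + 1) tSeries = MvPolynomial.X n.succPNat := by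
  rw [tSeries, coeff_mk, dif_pos n.succ_pos]
  rfl

theorem coeffwise_pderiv_tSeries (i : ℕ+) :
    coeffwise (MvPolynomial.pderiv i) tSeries = X ^ (i : ℕ) := by
  ext1 n
  rw [coeff_coeffwise, tSeries, coeff_mk, coeff_X_pow]
  split_ifs with hn hi hi
  · subst hi
    exact MvPolynomial.pderiv_X_self i
  · exact MvPolynomial.pderiv_X_of_ne fun h => hi (congrArg PNat.val h)
  · exact absurd (hi ▸ i.pos) hn
  · exact map_zero _

theorem coeffwise_pderiv_pSeries (i : ℕ+) :
    coeffwise (MvPolynomial.pderiv i) pSeries = pSeries * X ^ (i : ℕ) := by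
  rw [pSeries, coeffwise_exp_subst _ constantCoeff_tSeries, coeffwise_pderiv_tSeries]

/-- The value of `∑ p_n z^n` at `[x_1] + ⋯ + [x_k]`, which is the generating series of the complete
symmetric functions of `x_1, …, x_k`. -/
def hSeries (k : ℕ) : (MvPowerSeries ℕ ℂ)⟦X⟧ :=
  pSeries.map (MvPolynomial.aeval (R := ℂ) (xPoint k)).toRingHom

theorem constantCoeff_hSeries (k : ℕ) : constantCoeff (hSeries k) = 1 := by
  rw [hSeries, ← coeff_zero_eq_constantCoeff_apply, coeff_map, coeff_zero_eq_constantCoeff_apply,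
    pSeries, constantCoeff_exp_subst constantCoeff_tSeries, map_one]

theorem aeval_xPoint_coeff_derivative_tSeries (k n : ℕ) :
    MvPolynomial.aeval (R := ℂ) (xPoint k) (coeff n (d⁄dX _ tSeries)) =
      ∑ i ∈ Finset.range k, (MvPowerSeries.X i : MvPowerSeries ℕ ℂ) ^ (n + 1) := by
  have hcast : (n + 1 : MvPowerSeries ℕ ℂ) = algebraMap ℂ _ (n + 1 : ℂ) := by simp
  rw [coeff_derivative, coeff_succ_tSeries, map_mul, MvPolynomial.aeval_X, xPoint, Finset.sum_mul]
  refine Finset.sum_congr rfl fun i _ => ?_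
  rw [map_add, map_natCast, map_one, hcast, mul_comm, ← Algebra.smul_def, smul_smul,
    Nat.succPNat_coe, Nat.cast_succ, mul_inv_cancel₀ n.cast_add_one_ne_zero, one_smul]

theorem derivative_hSeries (k : ℕ) :
    d⁄dX _ (hSeries k) = hSeries k *
      ∑ i ∈ Finset.range k, mk fun n => (MvPowerSeries.X i : MvPowerSeries ℕ ℂ) ^ (n + 1) := by
  have hmap : (d⁄dX _ tSeries).map (MvPolynomial.aeval (R := ℂ) (xPoint k)).toRingHom =
      ∑ i ∈ Finset.range k, mk fun n => (MvPowerSeries.X i : MvPowerSeries ℕ ℂ) ^ (n + 1) := by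
    ext1 n
    rw [coeff_map, map_sum]
    simpa using aeval_xPoint_coeff_derivative_tSeries k n
  rw [← hmap, hSeries, ← map_mul, pSeries, ← derivative_exp_subst constantCoeff_tSeries]
  ext1 n
  simp [coeff_derivative]

theorem hSeries_zero : hSeries 0 = 1 := by
  rw [← sub_eq_zero]
  refine eq_zero_of_derivative_eq_mul (P := 0) ?_ ?_
  · simp [derivative_hSeries]
  · simp [constantCoeff_hSeries]

theorem hSeries_succ_mul (k : ℕ) :
    hSeries (k + 1) * (1 - C (MvPowerSeries.X k) * X) = hSeries k := by
  rw [← sub_eq_zero]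
  refine eq_zero_of_derivative_eq_mul (P := ∑ i ∈ Finset.range k,
    mk fun n => (MvPowerSeries.X i : MvPowerSeries ℕ ℂ) ^ (n + 1)) ?_ ?_
  · have hgeom : (mk fun n => (MvPowerSeries.X k : MvPowerSeries ℕ ℂ) ^ (n + 1)) *
        (1 - C (MvPowerSeries.X k) * X) = C (MvPowerSeries.X k) := by
      have hshift : (mk fun n => (MvPowerSeries.X k : MvPowerSeries ℕ ℂ) ^ (n + 1)) =
          C (MvPowerSeries.X k) * mk fun n => MvPowerSeries.X k ^ n := by
        ext1 n
        rw [coeff_mk, coeff_C_mul, coeff_mk, pow_succ']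
      rw [hshift, mul_assoc, mk_pow_mul_one_sub, mul_one]
    have hfactor : d⁄dX _ (1 - C (MvPowerSeries.X k : MvPowerSeries ℕ ℂ) * X) =
        -C (MvPowerSeries.X k) := by
      simp
    rw [map_sub, Derivation.leibniz, hfactor, derivative_hSeries, derivative_hSeries,
      Finset.sum_range_succ, smul_eq_mul, smul_eq_mul]
    linear_combination hSeries (k + 1) * hgeom
  · simp [constantCoeff_hSeries]

/-- The polynomial `∏ (1 - x_i z)` in `z`, whose coefficients are the signed elementary symmetric
functions of `x_1, …, x_k`. -/
def ePoly (k : ℕ) : Polynomial (MvPowerSeries ℕ ℂ) :=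
  ∏ i ∈ Finset.range k, (1 - Polynomial.C (MvPowerSeries.X i) * Polynomial.X)

theorem natDegree_ePoly_le (k : ℕ) : (ePoly k).natDegree ≤ k := by
  refine (Polynomial.natDegree_prod_le _ _).trans ?_
  calc _ ≤ ∑ _i ∈ Finset.range k, 1 := Finset.sum_le_sum fun i _ => by compute_degree
    _ = k := by simp

theorem ePoly_coeff_zero (k : ℕ) : (ePoly k).coeff 0 = 1 := by
  simp [Polynomial.coeff_zero_eq_eval_zero, ePoly, Polynomial.eval_prod]

theorem coe_ePoly_succ (k : ℕ) :
    (ePoly (k + 1) : (MvPowerSeries ℕ ℂ)⟦X⟧) =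
      (ePoly k : (MvPowerSeries ℕ ℂ)⟦X⟧) * (1 - C (MvPowerSeries.X k) * X) := by
  simp [ePoly, Finset.prod_range_succ]

theorem hSeries_mul_ePoly (k : ℕ) : hSeries k * (ePoly k : (MvPowerSeries ℕ ℂ)⟦X⟧) = 1 := by
  induction k with
  | zero => simp [hSeries_zero, ePoly]
  | succ k ih => rw [coe_ePoly_succ, mul_left_comm, hSeries_succ_mul, mul_comm, ih]

theorem hSeries_succ_mul_ePoly (k : ℕ) :
    hSeries (k + 1) * (ePoly k : (MvPowerSeries ℕ ℂ)⟦X⟧) =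
      mk fun n => MvPowerSeries.X k ^ n := by
  refine left_inv_eq_right_inv (a := 1 - C (MvPowerSeries.X k) * X) ?_ ?_
  · rw [mul_assoc, ← coe_ePoly_succ, hSeries_mul_ePoly]
  · rw [mul_comm, mk_pow_mul_one_sub]

theorem schurSeq_eq_jacobiTrudi (l : ℕ) (f : ℕ → ℕ) :
    schurSeq l f = jacobiTrudi pSeries fun i : Fin l => (f i : ℤ) - (i : ℕ) := by
  simp only [schurSeq, jacobiTrudi, pPoly_eq_intCoeff]

theorem evalX_jacobiTrudi (k : ℕ) {N : ℕ} (b : Fin N → ℤ) :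
    evalX k ((jacobiTrudi pSeries b : MvPolynomial ℕ+ ℂ) : MvPowerSeries ℕ+ ℂ) =
      jacobiTrudi (hSeries k) b := by
  rw [evalX, MvPowerSeries.subst_coe, hSeries, jacobiTrudi_map]
  rfl

theorem evalX_schurSeq (k l : ℕ) (f : ℕ → ℕ) :
    evalX k (schurSeq l f : MvPowerSeries ℕ+ ℂ) =
      jacobiTrudi (hSeries k) fun i : Fin l => (f i : ℤ) - (i : ℕ) := by
  rw [schurSeq_eq_jacobiTrudi, evalX_jacobiTrudi]

/-- When the `l`-th entry of `I` is subtracted from row `φ l` for every `l`, the total amount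
subtracted from each row. -/
def rowDecrement {N m : ℕ} (I : Fin m → ℕ+) (φ : Fin m → Fin N) : Fin N → ℤ :=
  ∑ l, Pi.single (φ l) ((I l : ℕ) : ℤ)

theorem dList_jacobiTrudi {N m : ℕ} (I : Fin m → ℕ+) (b : Fin N → ℤ) :
    dList (List.ofFn I) ((jacobiTrudi pSeries b : MvPolynomial ℕ+ ℂ) : MvPowerSeries ℕ+ ℂ) =
      ∑ φ : Fin m → Fin N, ((jacobiTrudi pSeries (b - rowDecrement I φ) : MvPolynomial ℕ+ ℂ) :
        MvPowerSeries ℕ+ ℂ) := by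
  induction m with
  | zero => simp [dList, rowDecrement]
  | succ m ih =>
    rw [List.ofFn_succ, dList, List.foldr_cons, ← dList, ih, map_sum,
      ← Equiv.sum_comp (Fin.consEquiv fun _ => Fin N), Fintype.sum_prod_type, Finset.sum_comm]
    refine Finset.sum_congr rfl fun φ _ => ?_
    rw [MvPowerSeries.pderiv_coe, derivation_jacobiTrudi (coeffwise_pderiv_pSeries (I 0)),
      ← MvPolynomial.coeToMvPowerSeries.ringHom_apply, map_sum]
    refine Finset.sum_congr rfl fun r _ => ?_
    rw [MvPolynomial.coeToMvPowerSeries.ringHom_apply, sub_sub]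
    simp [rowDecrement, Fin.sum_univ_succ, add_comm]

theorem evalX_dList_jacobiTrudi (k : ℕ) {N m : ℕ} (I : Fin m → ℕ+) (b : Fin N → ℤ) :
    evalX k (dList (List.ofFn I)
        ((jacobiTrudi pSeries b : MvPolynomial ℕ+ ℂ) : MvPowerSeries ℕ+ ℂ)) =
      ∑ φ : Fin m → Fin N, jacobiTrudi (hSeries k) (b - rowDecrement I φ) := by
  rw [dList_jacobiTrudi, evalX, ← MvPowerSeries.substAlgHom_apply (hasSubst_xPoint k), map_sum]
  simp only [MvPowerSeries.substAlgHom_apply, ← evalX_jacobiTrudi, evalX]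

end Specialization

section Combinatorics

theorem exists_perm_eq_comp_of_range_subset {α β : Type*} [Finite α] {ι φ : α → β}
    (hι : Function.Injective ι) (h : Set.range ι ⊆ Set.range φ) :
    ∃ s : Equiv.Perm α, φ = ι ∘ s := by
  choose ψ hψ using fun a => h (Set.mem_range_self a)
  have hψ_inj : Function.Injective ψ := fun a b hab => hι (by rw [← hψ, ← hψ, hab])
  let e := Equiv.ofBijective ψ (Finite.injective_iff_bijective.1 hψ_inj)
  exact ⟨e.symm, funext fun a => by
    rw [Function.comp_apply, ← hψ]
    exact congrArg φ (e.apply_symm_apply a).symm⟩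

/-- Comparing `∑ d²` with `∑ (d ∘ s)²` shows that `e ∘ t` minimises the sum of products with the
decreasing function `d - e`, so the equality case of the rearrangement inequality gives `t = 1`. -/
theorem perm_eq_one_of_sub_eq {ι α : Type*} [Finite ι] [LinearOrder ι] [CommRing α]
    [LinearOrder α] [IsStrictOrderedRing α] {d e : ι → α} (hd : StrictAnti d) (he : StrictMono e)
    {s t : Equiv.Perm ι} (h : ∀ i, d (s i) - (d i - e i) = e (t i)) : s = 1 := by
  cases nonempty_fintype ι
  have ha : StrictAnti (d - e) := fun i j hij => sub_lt_sub (hd hij) (he hij)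
  have hanti : Antivary (d - e) e := fun i j hij => ha.antitone (he.lt_iff_lt.1 hij).le
  have hsum : ∑ i, (d - e) i * e (t i) = ∑ i, (d - e) i * e i := by
    have hsq : ∑ i, ((d - e) i + e (t i)) ^ 2 = ∑ i, ((d - e) i + e i) ^ 2 := by
      simp only [← h, Pi.sub_apply, add_sub_cancel, sub_add_cancel]
      exact Equiv.sum_comp s fun i => d i ^ 2
    simp only [add_sq, Finset.sum_add_distrib, Equiv.sum_comp t fun i => e i ^ 2, mul_assoc,
      ← Finset.mul_sum] at hsq
    linarith
  have hanti_t : Antivary (d - e) (e ∘ t) := hanti.sum_mul_eq_sum_mul_comp_perm_iff.1 hsum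
  have ht_mono : StrictMono t := by
    refine Monotone.strictMono_of_injective (fun i j hij => ?_) t.injective
    refine he.le_iff_le.1 (not_lt.1 fun hlt => ?_)
    have := ha.le_iff_ge.1 (hanti_t hlt)
    have hji : i = j := le_antisymm hij this
    exact absurd hlt (by simp [hji])
  have ht : ⇑t = id := (ht_mono.range_inj strictMono_id).1 (by simp)
  refine Equiv.ext fun i => hd.injective ?_
  have := h i
  rw [ht, id, sub_eq_iff_eq_add, add_sub_cancel] at this
  exact this

/-- The rows of index at least `k` of an `N`-rowed matrix. -/
def lastRows (N k : ℕ) : Finset (Fin N) := {r | k ≤ (r : ℕ)}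

@[simp]
theorem mem_lastRows {N k : ℕ} {r : Fin N} : r ∈ lastRows N k ↔ k ≤ (r : ℕ) := by
  simp [lastRows]

theorem sum_lastRows {M : Type*} [AddCommMonoid M] (N k : ℕ) (f : ℕ → M) :
    ∑ r ∈ lastRows N k, f r = ∑ l ∈ Finset.range (N - k), f (k + l) := by
  rw [lastRows, Finset.sum_filter, Fin.sum_univ_eq_sum_range fun r => if k ≤ r then f r else 0,
    ← Finset.sum_filter, ← Finset.sum_Ico_eq_sum_range]
  refine Finset.sum_congr ?_ fun _ _ => rfl
  ext r
  simp only [Finset.mem_filter, Finset.mem_range, Finset.mem_Ico]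
  omega

theorem eq_lastRows_of_sum_le {N k : ℕ} {a : Fin N → ℤ} (ha : StrictAnti a) {S : Finset (Fin N)}
    (hcard : S.card = (lastRows N k).card) (hsum : ∑ r ∈ S, a r ≤ ∑ r ∈ lastRows N k, a r) :
    S = lastRows N k := by
  set T := lastRows N k
  by_contra hne
  have hc : (S \ T).card = (T \ S).card := Finset.card_sdiff_comm hcard
  have hnonempty : (S \ T).Nonempty := by
    rw [Finset.sdiff_nonempty]
    exact fun hsub => hne (Finset.eq_of_subset_of_card_le hsub hcard.ge)
  obtain ⟨s, hs, hmin⟩ := Finset.exists_min_image (S \ T) a hnonempty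
  have hS : (S \ T).card • a s ≤ ∑ r ∈ S \ T, a r := Finset.card_nsmul_le_sum _ _ _ hmin
  have hT : ∑ r ∈ T \ S, a r ≤ (T \ S).card • (a s - 1) := by
    refine Finset.sum_le_card_nsmul _ _ _ fun t ht => Int.le_sub_one_of_lt (ha ?_)
    simp only [T, Finset.mem_sdiff, mem_lastRows] at hs ht
    rw [Fin.lt_def]
    omega
  have hdiff := Finset.sum_sdiff_sub_sum_sdiff (s₁ := S) (s₂ := T) (f := a)
  have hpos : (0 : ℤ) < (S \ T).card := by exact_mod_cast hnonempty.card_pos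
  rw [← hc, nsmul_eq_mul, mul_sub, ← nsmul_eq_mul] at hT
  omega

section Decrement

variable {N k : ℕ} {f : ℕ → ℕ} {d : Fin N → ℤ} {σ : Equiv.Perm (Fin N)}
  (hf : Antitone f) (hd : 0 ≤ d) (hweight : ∑ r, d r ≤ ∑ r ∈ lastRows N k, (f r : ℤ))
  (hσ : ∀ j : Fin N, k ≤ j → (f (σ j) : ℤ) - (σ j : ℕ) - d (σ j) = -((j : ℕ) : ℤ))

include hf hd hweight hσ

theorem map_lastRows_eq : (lastRows N k).map σ.toEmbedding = lastRows N k := by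
  have hanti : StrictAnti fun r : Fin N => (f r : ℤ) - (r : ℕ) := fun i j hij => by
    have := hf (Fin.le_def.1 hij.le)
    have := Fin.lt_def.1 hij
    lia
  refine eq_lastRows_of_sum_le hanti (Finset.card_map _) ?_
  have hdec : ∑ j ∈ lastRows N k, d (σ j) ≤ ∑ r, d r := by
    rw [← Equiv.sum_comp σ d]
    exact Finset.sum_le_univ_sum_of_nonneg fun r => hd _
  calc ∑ r ∈ (lastRows N k).map σ.toEmbedding, ((f r : ℤ) - (r : ℕ))
      = ∑ j ∈ lastRows N k, (d (σ j) - ((j : ℕ) : ℤ)) := by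
        rw [Finset.sum_map]
        refine Finset.sum_congr rfl fun j hj => ?_
        have := hσ j (mem_lastRows.1 hj)
        rw [Equiv.coe_toEmbedding]
        linarith
    _ ≤ ∑ r ∈ lastRows N k, ((f r : ℤ) - (r : ℕ)) := by
        rw [Finset.sum_sub_distrib, Finset.sum_sub_distrib]
        linarith

theorem sum_lastRows_decrement : ∑ r ∈ lastRows N k, d r = ∑ r ∈ lastRows N k, (f r : ℤ) := by
  have hperm : ∀ h : Fin N → ℤ, ∑ j ∈ lastRows N k, h (σ j) = ∑ r ∈ lastRows N k, h r := fun h => by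
    conv_rhs => rw [← map_lastRows_eq hf hd hweight hσ, Finset.sum_map]
    rfl
  have hsum := Finset.sum_congr rfl fun j hj => hσ j (mem_lastRows.1 hj)
  rw [hperm fun r => (f r : ℤ) - (r : ℕ) - d r, Finset.sum_sub_distrib, Finset.sum_sub_distrib,
    Finset.sum_neg_distrib] at hsum
  linarith

end Decrement

end Combinatorics

section RowDecrement

variable {N m : ℕ} (I : Fin m → ℕ+) (φ : Fin m → Fin N)

theorem rowDecrement_apply (r : Fin N) :
    rowDecrement I φ r = ∑ l, if φ l = r then ((I l : ℕ) : ℤ) else 0 := by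
  simp [rowDecrement, Finset.sum_apply, Pi.single_apply, eq_comm]

theorem rowDecrement_nonneg : 0 ≤ rowDecrement I φ :=
  Finset.sum_nonneg fun _ _ => Pi.single_nonneg.2 (Nat.cast_nonneg _)

theorem sum_rowDecrement : ∑ r, rowDecrement I φ r = ∑ l, ((I l : ℕ) : ℤ) := by
  simp only [rowDecrement_apply]
  rw [Finset.sum_comm]
  simp

variable {I φ}

theorem mem_range_of_rowDecrement_ne_zero {r : Fin N} (h : rowDecrement I φ r ≠ 0) :
    r ∈ Set.range φ := by
  rw [rowDecrement_apply] at h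
  obtain ⟨l, -, hl⟩ := Finset.exists_ne_zero_of_sum_ne_zero h
  exact ⟨l, of_not_not fun hne => hl (if_neg hne)⟩

theorem rowDecrement_apply_of_injective (hφ : Function.Injective φ) (l : Fin m) :
    rowDecrement I φ (φ l) = (I l : ℕ) := by
  simp [rowDecrement_apply, hφ.eq_iff]

end RowDecrement

section Partitions

theorem jacobiTrudi_of_last_eq_neg {R : Type*} [CommRing R] {F : PowerSeries R}
    (hF : PowerSeries.constantCoeff F = 1) {l : ℕ} {b : Fin (l + 1) → ℤ}
    (hb : b (Fin.last l) = -(l : ℤ)) :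
    jacobiTrudi F b = jacobiTrudi F fun i : Fin l => b i.castSucc := by
  have hentry : ∀ j : Fin l, intCoeff (-(l : ℤ) + (j : ℕ)) F = 0 := fun j =>
    intCoeff_of_neg (by have := j.2; omega) F
  rw [jacobiTrudi, Matrix.det_succ_row _ (Fin.last l), Fin.sum_univ_castSucc]
  simp only [Matrix.of_apply, Fin.val_castSucc, Fin.val_last, hb, hentry, mul_zero, zero_mul,
    Finset.sum_const_zero, zero_add, neg_add_cancel, Fin.succAbove_last, ← two_mul, pow_mul,
    neg_one_sq, one_pow, one_mul]
  rw [← Nat.cast_zero, intCoeff_natCast, PowerSeries.coeff_zero_eq_constantCoeff_apply, hF, one_mul]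
  rfl

theorem constantCoeff_pSeries : PowerSeries.constantCoeff pSeries = 1 :=
  constantCoeff_exp_subst constantCoeff_tSeries

theorem schurSeq_succ_of_eq_zero {l : ℕ} {f : ℕ → ℕ} (h : f l = 0) :
    schurSeq (l + 1) f = schurSeq l f := by
  rw [schurSeq_eq_jacobiTrudi, jacobiTrudi_of_last_eq_neg constantCoeff_pSeries (by simp [h]),
    schurSeq_eq_jacobiTrudi]
  rfl

theorem rowLen_eq_zero {μ : YoungDiagram} {i : ℕ} (h : μ.colLen 0 ≤ i) : μ.rowLen i = 0 :=
  Nat.eq_zero_of_not_pos fun hpos => h.not_gt <|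
    YoungDiagram.mem_iff_lt_colLen.1 (YoungDiagram.mem_iff_lt_rowLen.2 hpos)

theorem schur_eq_schurSeq {μ : YoungDiagram} {N : ℕ} (h : μ.colLen 0 ≤ N) :
    schur μ = schurSeq N μ.rowLen := by
  induction N, h using Nat.le_induction with
  | base => rfl
  | succ n hn ih => rw [schurSeq_succ_of_eq_zero (rowLen_eq_zero hn), ih]

theorem rowLen_mono {μ ν : YoungDiagram} (h : μ ≤ ν) (i : ℕ) : μ.rowLen i ≤ ν.rowLen i :=
  not_lt.1 fun hlt => lt_irrefl _ <|
    YoungDiagram.mem_iff_lt_rowLen.1 (h (YoungDiagram.mem_iff_lt_rowLen.2 hlt))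

theorem card_eq_sum_rowLen {μ : YoungDiagram} {N : ℕ} (h : μ.colLen 0 ≤ N) :
    μ.card = ∑ r : Fin N, μ.rowLen r := by
  rw [Fin.sum_univ_eq_sum_range, YoungDiagram.card, Finset.card_eq_sum_card_fiberwise
    (f := Prod.fst) (t := Finset.range N)]
  · exact Finset.sum_congr rfl fun r _ => μ.rowLen_eq_card.symm
  · rintro ⟨i, j⟩ hij
    exact Finset.mem_coe.2 <| Finset.mem_range.2 <| (YoungDiagram.mem_iff_lt_colLen.1 <|
      μ.up_left_mem le_rfl (Nat.zero_le j) hij).trans_le h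

end Partitions

section Gaps

variable {B : Finset ℕ} {k : ℕ}

theorem lamPart_sub {r : ℕ} (hr : r < B.card) :
    (lamPart B r : ℤ) - r = gap B (B.card - 1 - r) - (B.card - 1 : ℤ) := by
  have : B.card - 1 - r ≤ gap B (B.card - 1 - r) := Nat.le_nth (gap_cond (by omega))
  rw [lamPart, if_pos hr, Nat.cast_sub this]
  omega

theorem lamPart_of_le {r : ℕ} (hr : B.card ≤ r) : lamPart B r = 0 := if_neg hr.not_gt

theorem lamPart_le_rowLen {μ : YoungDiagram} (hμ : lam B ≤ μ) (r : ℕ) :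
    lamPart B r ≤ μ.rowLen r :=
  (rowLen_lam B r).symm.trans_le (rowLen_mono hμ r)

theorem colLen_zero_lam_le (B : Finset ℕ) : (lam B).colLen 0 ≤ B.card := by
  refine not_lt.1 fun h => ?_
  have := YoungDiagram.mem_iff_lt_rowLen.1 (YoungDiagram.mem_iff_lt_colLen.2 h)
  rw [rowLen_lam, lamPart_of_le le_rfl] at this
  exact lt_irrefl _ this

theorem mNum_le (B : Finset ℕ) (k : ℕ) : mNum B k ≤ B.card - k :=
  (Nat.le_add_left _ _).trans_eq (count_add_mNum B k)

/-- The sequence `A_k`, indexed by `Fin m_k` and with positive entries by its type. -/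
def aFun (B : Finset ℕ) (k : ℕ) (i : Fin (mNum B k)) : ℕ+ :=
  ⟨gap B (B.card - k - 1 - i) - nongap B i, aSeq_pos i.2⟩

theorem aSeq_eq_ofFn (B : Finset ℕ) (k : ℕ) : aSeq B k = List.ofFn (aFun B k) := rfl

theorem coe_aFun (i : Fin (mNum B k)) :
    ((aFun B k i : ℕ) : ℤ) = gap B (B.card - k - 1 - i) - nongap B i :=
  Nat.cast_sub (Nat.lt_of_sub_pos (aSeq_pos i.2)).le

theorem sum_topRow (B : Finset ℕ) (k : ℕ) :
    ∑ l ∈ Finset.range (B.card - k), (topRow B k l : ℤ) =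
      ∑ l ∈ Finset.range (B.card - k), (l : ℤ) := by
  rw [← Fin.sum_univ_eq_sum_range fun l => (topRow B k l : ℤ),
    ← Fin.sum_univ_eq_sum_range fun l => (l : ℤ)]
  exact Equiv.sum_comp (topRowEquiv B k) fun l : Fin (B.card - k) => ((l : ℕ) : ℤ)

theorem sum_gap_sub_topRow (B : Finset ℕ) (k : ℕ) :
    ∑ l ∈ Finset.range (B.card - k), ((gap B (B.card - k - 1 - l) : ℤ) - topRow B k l) =
      ∑ i, ((aFun B k i : ℕ) : ℤ) := by
  simp only [coe_aFun]
  rw [Fin.sum_univ_eq_sum_range fun i => (gap B (B.card - k - 1 - i) : ℤ) - nongap B i,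
    ← Finset.sum_subset (Finset.range_subset_range.2 (mNum_le B k))]
  · refine Finset.sum_congr rfl fun l hl => ?_
    rw [topRow, if_pos (Finset.mem_range.1 hl)]
  · intro l _ hl
    rw [topRow, if_neg (mt Finset.mem_range.2 hl), sub_self]

theorem sum_aFun {N : ℕ} (hN : B.card ≤ N) :
    ∑ i, ((aFun B k i : ℕ) : ℤ) = ∑ r ∈ lastRows N k, (lamPart B r : ℤ) := by
  rw [sum_lastRows N k fun r => (lamPart B r : ℤ), ← sum_gap_sub_topRow, Finset.sum_sub_distrib,
    sum_topRow, ← Finset.sum_range_reflect (fun l => (l : ℤ)), ← Finset.sum_sub_distrib,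
    ← Finset.sum_subset (Finset.range_subset_range.2 (Nat.sub_le_sub_right hN k))]
  · refine Finset.sum_congr rfl fun l hl => ?_
    have hl := Finset.mem_range.1 hl
    have := lamPart_sub (B := B) (r := k + l) (by omega)
    rw [show B.card - 1 - (k + l) = B.card - k - 1 - l by omega] at this
    push_cast at this
    omega
  · intro l _ hl
    rw [Finset.mem_range] at hl
    rw [lamPart_of_le (by omega), Nat.cast_zero]

/-- The rows `k, …, k + m_k - 1`, to which the entries of `A_k` belong in this order. -/
def tailRows (B : Finset ℕ) (k : ℕ) (i : Fin (mNum B k)) : Fin B.card :=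
  ⟨k + i, by have := mNum_le B k; omega⟩

theorem tailRows_injective (B : Finset ℕ) (k : ℕ) : Function.Injective (tailRows B k) :=
  fun _ _ h => Fin.ext (Nat.add_left_cancel (congrArg Fin.val h))

theorem rowDecrement_tailRows {φ : Fin (mNum B k) → Fin B.card} {s : Equiv.Perm (Fin (mNum B k))}
    (hφ : φ = tailRows B k ∘ s) (i : Fin (mNum B k)) :
    rowDecrement (aFun B k) φ (tailRows B k (s i)) = (aFun B k i : ℕ) := by
  subst hφ
  exact rowDecrement_apply_of_injective ((tailRows_injective B k).comp s.injective) i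

theorem rowDecrement_eq_zero {φ : Fin (mNum B k) → Fin B.card} {s : Equiv.Perm (Fin (mNum B k))}
    (hφ : φ = tailRows B k ∘ s) {r : Fin B.card} (hr : (r : ℕ) < k ∨ k + mNum B k ≤ r) :
    rowDecrement (aFun B k) φ r = 0 := by
  by_contra hne
  obtain ⟨i, rfl⟩ := mem_range_of_rowDecrement_ne_zero hne
  have := (s i).2
  simp only [hφ, tailRows, Function.comp_apply] at hr
  omega

theorem gap_sub_rowDecrement_tailRows (l : Fin (B.card - k)) :
    (gap B (B.card - k - 1 - l) : ℤ) -
      rowDecrement (aFun B k) (tailRows B k) ⟨k + l, by omega⟩ = topRow B k l := by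
  have hφ : tailRows B k = tailRows B k ∘ (1 : Equiv.Perm (Fin (mNum B k))) := rfl
  rw [topRow]
  split_ifs with hl
  · have := rowDecrement_tailRows hφ ⟨l, hl⟩
    rw [coe_aFun] at this
    exact sub_eq_of_eq_add (by rw [← sub_eq_iff_eq_add']; exact this.symm)
  · rw [rowDecrement_eq_zero hφ (Or.inr (Nat.add_le_add_left (not_lt.1 hl) k)), sub_zero]

section Uniqueness

variable {φ : Fin (mNum B k) → Fin B.card} {v : Fin (B.card - k) → Fin (B.card - k)}
  (hv : ∀ l : Fin (B.card - k), (gap B (B.card - k - 1 - l) : ℤ) -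
    rowDecrement (aFun B k) φ ⟨k + l, by omega⟩ = (v l : ℕ))

include hv

theorem exists_perm_eq_tailRows_comp : ∃ s : Equiv.Perm (Fin (mNum B k)), φ = tailRows B k ∘ s := by
  refine exists_perm_eq_comp_of_range_subset (tailRows_injective B k) ?_
  rintro _ ⟨i, rfl⟩
  refine mem_range_of_rowDecrement_ne_zero (I := aFun B k) fun hzero => ?_
  have hi : (i : ℕ) < B.card - k := i.2.trans_le (mNum_le B k)
  have hval : (gap B (B.card - k - 1 - i) : ℤ) - rowDecrement (aFun B k) φ (tailRows B k i) =
    (v ⟨i, hi⟩ : ℕ) := hv ⟨i, hi⟩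
  have hgap := le_gap (B := B) (k := k) (i := B.card - k - 1 - i) (by omega) (by omega)
  have := (v ⟨i, hi⟩).2
  rw [hzero] at hval
  omega

theorem exists_perm_gap_sub_eq_nongap (hinj : Function.Injective v)
    {s : Equiv.Perm (Fin (mNum B k))} (hs : φ = tailRows B k ∘ s) :
    ∃ t : Equiv.Perm (Fin (mNum B k)), ∀ i,
      (gap B (B.card - k - 1 - s i) : ℤ) - (aFun B k i : ℕ) = nongap B (t i) := by
  have hle := mNum_le B k
  have hvs : ∀ i, (gap B (B.card - k - 1 - s i) : ℤ) - (aFun B k i : ℕ) =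
      v (Fin.castLE hle (s i)) := fun i => by
    rw [← hv, ← rowDecrement_tailRows hs i]
    rfl
  have hmem : ∀ i, ∃ j : Fin (mNum B k), nongap B j = v (Fin.castLE hle (s i)) := by
    intro i
    obtain ⟨j, hj⟩ := (topRowEquiv B k).surjective (v (Fin.castLE hle (s i)))
    have hj' : topRow B k j = v (Fin.castLE hle (s i)) := congrArg Fin.val hj
    rw [topRow] at hj'
    split_ifs at hj' with hjm
    · exact ⟨⟨j, hjm⟩, hj'⟩
    · have hvj := hv j
      rw [rowDecrement_eq_zero hs (Or.inr (Nat.add_le_add_left (not_lt.1 hjm) k)),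
        sub_zero, hj', Nat.cast_inj, Fin.val_inj] at hvj
      rw [← hinj hvj] at hjm
      exact absurd (s i).2 hjm
  choose t ht using hmem
  have ht_inj : Function.Injective t := fun i j hij => by
    have hval : nongap B (t i) = nongap B (t j) := by rw [hij]
    rw [ht, ht] at hval
    have := hinj (Fin.ext hval)
    exact s.injective (Fin.castLE_injective hle this)
  exact ⟨Equiv.ofBijective t (Finite.injective_iff_bijective.1 ht_inj), fun i => by
    rw [hvs, ← ht]
    rfl⟩

theorem eq_tailRows (hinj : Function.Injective v) : φ = tailRows B k := by
  obtain ⟨s, hs⟩ := exists_perm_eq_tailRows_comp hv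
  obtain ⟨t, ht⟩ := exists_perm_gap_sub_eq_nongap hv hinj hs
  have hgap : StrictAnti fun i : Fin (mNum B k) => (gap B (B.card - k - 1 - i) : ℤ) :=
    fun i j hij => by
      have := mNum_le B k
      have := Fin.lt_def.1 hij
      exact Nat.cast_lt.2 (gap_lt_gap (by omega) (by omega))
  have hnongap : StrictMono fun i : Fin (mNum B k) => (nongap B i : ℤ) := fun i j hij =>
    Nat.cast_lt.2 (Nat.nth_strictMono (nongap_infinite B) hij)
  have hs1 : s = 1 := perm_eq_one_of_sub_eq hgap hnongap fun i => by
    rw [← ht, coe_aFun]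
  rw [hs, hs1]
  rfl

end Uniqueness

end Gaps

section SchurDerivatives

theorem exists_perm_of_jacobiTrudi_hSeries_ne_zero {k N : ℕ} {b : Fin N → ℤ}
    (h : jacobiTrudi (hSeries k) b ≠ 0) :
    ∃ σ : Equiv.Perm (Fin N), ∀ j : Fin N, k ≤ j → b (σ j) = -((j : ℕ) : ℤ) :=
  exists_perm_of_jacobiTrudi_ne_zero (natDegree_ePoly_le k) (ePoly_coeff_zero k)
    (hSeries_mul_ePoly k) h

theorem evalX_dList_schur (k : ℕ) {μ : YoungDiagram} {m N : ℕ} (hN : μ.colLen 0 ≤ N)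
    (I : Fin m → ℕ+) :
    evalX k (dList (List.ofFn I) (schur μ : MvPowerSeries ℕ+ ℂ)) = ∑ φ : Fin m → Fin N,
      jacobiTrudi (hSeries k)
        ((fun i : Fin N => (μ.rowLen i : ℤ) - (i : ℕ)) - rowDecrement I φ) := by
  rw [schur_eq_schurSeq hN, schurSeq_eq_jacobiTrudi, evalX_dList_jacobiTrudi]

theorem evalX_zero_dList_schur_of_sum_lt_card {μ : YoungDiagram} {I : List ℕ+}
    (hI : (I.map fun i : ℕ+ => (i : ℕ)).sum < μ.card) :
    evalX 0 (dList I (schur μ : MvPowerSeries ℕ+ ℂ)) = 0 := by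
  rw [← List.ofFn_get I, evalX_dList_schur 0 le_rfl]
  refine Finset.sum_eq_zero fun φ _ => by_contra fun hne => ?_
  obtain ⟨σ, hσ⟩ := exists_perm_of_jacobiTrudi_hSeries_ne_zero hne
  have hlast : lastRows (μ.colLen 0) 0 = Finset.univ := by ext; simp
  have hlt : ∑ r, rowDecrement I.get φ r < ∑ r ∈ lastRows (μ.colLen 0) 0, (μ.rowLen r : ℤ) := by
    rw [sum_rowDecrement, hlast, ← Nat.cast_sum, ← Nat.cast_sum, ← card_eq_sum_rowLen le_rfl]
    rw [← List.ofFn_get I, List.map_ofFn, List.sum_ofFn] at hI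
    exact Nat.cast_lt.2 hI
  have heq := sum_lastRows_decrement μ.rowLen_anti (rowDecrement_nonneg I.get φ) hlt.le hσ
  rw [hlast] at heq hlt
  exact hlt.ne heq

theorem evalX_zero_dList_schur_of_length_mem {μ : YoungDiagram} {I : List ℕ+}
    (hI : (I.length, I.length) ∈ μ) : evalX 0 (dList I (schur μ : MvPowerSeries ℕ+ ℂ)) = 0 := by
  rw [← List.ofFn_get I, evalX_dList_schur 0 le_rfl]
  refine Finset.sum_eq_zero fun φ _ => by_contra fun hne => ?_
  obtain ⟨σ, hσ⟩ := exists_perm_of_jacobiTrudi_hSeries_ne_zero hne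
  have hsquare : ∀ r : Fin (I.length + 1), (r : ℕ) < μ.rowLen r := fun r =>
    YoungDiagram.mem_iff_lt_rowLen.1 (μ.up_left_mem r.is_le r.is_le hI)
  have hcol : I.length + 1 ≤ μ.colLen 0 :=
    YoungDiagram.mem_iff_lt_colLen.1 (μ.up_left_mem le_rfl (Nat.zero_le _) hI)
  have hhit : ∀ r : Fin (I.length + 1), ∃ l, φ l = Fin.castLE hcol r := fun r => by
    refine mem_range_of_rowDecrement_ne_zero (I := I.get) fun hzero => ?_
    have hval := hσ (σ.symm (Fin.castLE hcol r)) (Nat.zero_le _)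
    have := hsquare r
    rw [Equiv.apply_symm_apply, Pi.sub_apply, hzero, Fin.val_castLE] at hval
    omega
  choose ψ hψ using hhit
  have hψ_inj : Function.Injective ψ := fun r s hrs =>
    Fin.castLE_injective hcol (by rw [← hψ, ← hψ, hrs])
  have := Fintype.card_le_of_injective ψ hψ_inj
  simp at this

variable {B : Finset ℕ} {k : ℕ} {μ : YoungDiagram}

theorem length_mem_lam {n : ℕ} (h : n < mNum B 0) : (n, n) ∈ lam B := by
  have := mNum_le B 0
  have := le_gap (B := B) (k := 0) (i := B.card - 1 - n) (by omega) (by omega)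
  have := lamPart_sub (B := B) (r := n) (by omega)
  rw [YoungDiagram.mem_iff_lt_rowLen, rowLen_lam]
  omega

section TailOfSurvivingTerm

variable {N : ℕ} {φ : Fin (mNum B k) → Fin N} (hN : B.card ≤ N) (hμ : lam B ≤ μ)
include hN hμ

theorem sum_rowDecrement_aFun_le :
    ∑ r, rowDecrement (aFun B k) φ r ≤ ∑ r ∈ lastRows N k, (μ.rowLen r : ℤ) := by
  rw [sum_rowDecrement, sum_aFun hN]
  exact Finset.sum_le_sum fun r _ => Nat.cast_le.2 (lamPart_le_rowLen hμ r)

theorem rowLen_eq_lamPart_of_jacobiTrudi_ne_zero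
    (hne : jacobiTrudi (hSeries k)
      ((fun i : Fin N => (μ.rowLen i : ℤ) - (i : ℕ)) - rowDecrement (aFun B k) φ) ≠ 0)
    {r : Fin N} (hr : k ≤ r) : μ.rowLen r = lamPart B r := by
  obtain ⟨σ, hσ⟩ := exists_perm_of_jacobiTrudi_hSeries_ne_zero hne
  have hle : ∀ r ∈ lastRows N k, (lamPart B r : ℤ) ≤ μ.rowLen r := fun r _ =>
    Nat.cast_le.2 (lamPart_le_rowLen hμ r)
  have hsum : ∑ r ∈ lastRows N k, (lamPart B r : ℤ) = ∑ r ∈ lastRows N k, (μ.rowLen r : ℤ) := by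
    refine (Finset.sum_le_sum hle).antisymm ?_
    rw [← sum_lastRows_decrement μ.rowLen_anti (rowDecrement_nonneg (aFun B k) φ)
      (sum_rowDecrement_aFun_le hN hμ) hσ, ← sum_aFun hN, ← sum_rowDecrement (aFun B k) φ]
    exact Finset.sum_le_univ_sum_of_nonneg (rowDecrement_nonneg _ _)
  exact Nat.cast_injective ((Finset.sum_eq_sum_iff_of_le hle).1 hsum r (mem_lastRows.2 hr)).symm

end TailOfSurvivingTerm

theorem sameTail_of_forall {N : ℕ} (hk : k ≤ B.card) (hB : B.card ≤ N) (hμ : μ.colLen 0 ≤ N)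
    (h : ∀ r : Fin N, k ≤ (r : ℕ) → μ.rowLen r = lamPart B r) : SameTail B k μ := by
  refine ⟨not_lt.1 fun hlt => ?_, fun i hi hi' => ?_⟩
  · have hrow := h ⟨B.card, hlt.trans_le hμ⟩ hk
    rw [lamPart_of_le le_rfl] at hrow
    exact (YoungDiagram.mem_iff_lt_rowLen.1 (YoungDiagram.mem_iff_lt_colLen.2 hlt)).ne' hrow
  · rw [rowLen_lam]
    exact h ⟨i, hi'.trans_le hB⟩ hi

theorem evalX_dList_schur_of_not_sameTail (hk : k ≤ B.card) (hμ : lam B ≤ μ)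
    (hns : ¬SameTail B k μ) :
    evalX k (dList (aSeq B k) (schur μ : MvPowerSeries ℕ+ ℂ)) = 0 := by
  rw [aSeq_eq_ofFn, evalX_dList_schur k (le_max_right B.card (μ.colLen 0))]
  refine Finset.sum_eq_zero fun φ _ => by_contra fun hne => hns ?_
  exact sameTail_of_forall hk (le_max_left _ _) (le_max_right _ _) fun r hr =>
    rowLen_eq_lamPart_of_jacobiTrudi_ne_zero (le_max_left _ _) hμ hne hr

section SameTail

variable (hs : SameTail B k μ)
include hs

theorem rowLen_sub_of_sameTail (l : Fin (B.card - k)) :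
    (μ.rowLen (k + l) : ℤ) - (k + l : ℕ) = gap B (B.card - k - 1 - l) - (B.card - 1 : ℤ) := by
  rw [hs.2 _ (Nat.le_add_right k l) (by omega), rowLen_lam, lamPart_sub (by omega),
    show B.card - 1 - (k + (l : ℕ)) = B.card - k - 1 - l by omega]

theorem jacobiTrudi_sub_rowDecrement_tailRows (hk : k ≤ B.card) :
    jacobiTrudi (hSeries k) ((fun i : Fin B.card => (μ.rowLen i : ℤ) - (i : ℕ)) -
        rowDecrement (aFun B k) (tailRows B k)) =
      cSign B k • jacobiTrudi (hSeries k) fun i : Fin k => (μ.rowLen i : ℤ) - (i : ℕ) := by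
  rw [jacobiTrudi_eq_sign_smul (natDegree_ePoly_le k) (ePoly_coeff_zero k) (hSeries_mul_ePoly k)
    (Nat.add_sub_cancel' hk) _ ((topRowEquiv B k).trans Fin.revPerm), cSign,
    Equiv.Perm.sign_trans, Equiv.Perm.sign_trans, Equiv.Perm.sign_symm]
  · congr 2
    funext i
    rw [Pi.sub_apply, rowDecrement_eq_zero (φ := tailRows B k) (s := 1) rfl (Or.inl i.2), sub_zero]
  · intro l
    have hrev : ((((topRowEquiv B k).trans Fin.revPerm) l : Fin (B.card - k)) : ℕ) =
      B.card - k - (topRow B k l + 1) := Fin.val_rev _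
    have hlt := topRow_lt (B := B) (k := k) l.2
    have hval := gap_sub_rowDecrement_tailRows l
    rw [Pi.sub_apply, rowLen_sub_of_sameTail hs, hrev]
    omega

theorem eq_tailRows_of_jacobiTrudi_ne_zero (hμ : lam B ≤ μ) {φ : Fin (mNum B k) → Fin B.card}
    (hne : jacobiTrudi (hSeries k)
      ((fun i : Fin B.card => (μ.rowLen i : ℤ) - (i : ℕ)) - rowDecrement (aFun B k) φ) ≠ 0) :
    φ = tailRows B k := by
  obtain ⟨σ, hσ⟩ := exists_perm_of_jacobiTrudi_hSeries_ne_zero hne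
  have hmap := map_lastRows_eq μ.rowLen_anti (rowDecrement_nonneg (aFun B k) φ)
    (sum_rowDecrement_aFun_le le_rfl hμ) hσ
  let row (l : Fin (B.card - k)) : Fin B.card := ⟨k + l, by omega⟩
  have hsymm : ∀ l, k ≤ (σ.symm (row l) : ℕ) := fun l => by
    have : row l ∈ (lastRows B.card k).map σ.toEmbedding := by
      rw [hmap, mem_lastRows]
      exact Nat.le_add_right k l
    simpa using this
  let v (l : Fin (B.card - k)) : Fin (B.card - k) := ⟨B.card - 1 - σ.symm (row l), by
    have := hsymm l
    omega⟩
  refine eq_tailRows (v := v) (fun l => ?_) fun l l' h => ?_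
  · have hval := hσ (σ.symm (row l)) (hsymm l)
    rw [Equiv.apply_symm_apply, Pi.sub_apply, rowLen_sub_of_sameTail hs] at hval
    change _ - rowDecrement _ _ (row l) = ((B.card - 1 - σ.symm (row l) : ℕ) : ℤ)
    omega
  · have hrow : row l = row l' := σ.symm.injective (Fin.ext (by
      have := congrArg Fin.val h
      change B.card - 1 - (σ.symm (row l) : ℕ) = B.card - 1 - (σ.symm (row l') : ℕ) at this
      omega))
    exact Fin.ext (Nat.add_left_cancel (congrArg Fin.val hrow))

theorem evalX_dList_schur_of_sameTail (hk : k ≤ B.card) (hμ : lam B ≤ μ) :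
    evalX k (dList (aSeq B k) (schur μ : MvPowerSeries ℕ+ ℂ)) =
      (((cSign B k : ℤˣ) : ℤ) : ℂ) • evalX k (schurSeq k μ.rowLen : MvPowerSeries ℕ+ ℂ) := by
  rw [aSeq_eq_ofFn, evalX_dList_schur k hs.1, Finset.sum_eq_single (tailRows B k) (fun φ _ hφ =>
    not_not.1 (mt (eq_tailRows_of_jacobiTrudi_ne_zero hs hμ) hφ)) (by simp),
    jacobiTrudi_sub_rowDecrement_tailRows hs hk, evalX_schurSeq, Int.cast_smul_eq_zsmul]
  rfl

end SameTail

end SchurDerivatives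

section LeadingTerm

theorem X_dvd_jacobiTrudi_hSeries_succ_sub (n : ℕ) {N : ℕ} (b : Fin N → ℤ) :
    (MvPowerSeries.X n : MvPowerSeries ℕ ℂ) ∣
      jacobiTrudi (hSeries (n + 1)) b - jacobiTrudi (hSeries n) b := by
  let I := Ideal.span {(MvPowerSeries.X n : MvPowerSeries ℕ ℂ)}
  have hX : Ideal.Quotient.mk I (MvPowerSeries.X n) = 0 :=
    Ideal.Quotient.eq_zero_iff_mem.2 (Ideal.mem_span_singleton_self _)
  have hmap : (hSeries (n + 1)).map (Ideal.Quotient.mk I) =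
      (hSeries n).map (Ideal.Quotient.mk I) := by
    simp [← hSeries_succ_mul n, hX]
  rw [← Ideal.mem_span_singleton, ← Ideal.Quotient.eq, ← jacobiTrudi_map, hmap, jacobiTrudi_map]

/-- Column operations turn the last column into the powers of the last variable, so expanding along
it isolates the bottom right minor. -/
theorem X_pow_dvd_evalX_schurSeq_succ_sub (n : ℕ) {f : ℕ → ℕ} (hf : Antitone f) :
    (MvPowerSeries.X n : MvPowerSeries ℕ ℂ) ^ (f n + 1) ∣
      evalX (n + 1) (schurSeq (n + 1) f : MvPowerSeries ℕ+ ℂ) -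
        evalX n (schurSeq n f : MvPowerSeries ℕ+ ℂ) * MvPowerSeries.X n ^ f n := by
  have hcolumn : ∀ i ≤ n, intCoeff ((f i : ℤ) - (i : ℕ) + (n : ℕ))
      (PowerSeries.mk fun m => (MvPowerSeries.X n : MvPowerSeries ℕ ℂ) ^ m) =
        MvPowerSeries.X n ^ (f i + (n - i)) := fun i hi => by
    rw [show (f i : ℤ) - (i : ℕ) + (n : ℕ) = ((f i + (n - i) : ℕ) : ℤ) by omega, intCoeff_natCast,
      PowerSeries.coeff_mk]
  rw [evalX_schurSeq, evalX_schurSeq,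
    jacobiTrudi_eq_det_convolution (natDegree_ePoly_le n) (ePoly_coeff_zero n),
    hSeries_succ_mul_ePoly, Matrix.det_succ_column _ (Fin.last n), Fin.sum_univ_castSucc,
    add_sub_assoc]
  simp only [Matrix.of_apply, Fin.val_last, lt_irrefl, if_false, Fin.val_castSucc,
    Fin.succAbove_last, hcolumn n le_rfl, Nat.sub_self, Nat.add_zero,
    ← two_mul, pow_mul, neg_one_sq, one_pow, one_mul]
  refine dvd_add (Finset.dvd_sum fun i _ => ?_) ?_
  · rw [hcolumn i i.2.le]
    refine Dvd.dvd.mul_right (Dvd.dvd.mul_left (pow_dvd_pow _ ?_) _) _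
    have := hf i.2.le
    omega
  · have hminor : Matrix.det (Matrix.submatrix (Matrix.of fun i j : Fin (n + 1) =>
          intCoeff ((f i : ℤ) - (i : ℕ) + (j : ℕ)) (if (j : ℕ) < n then hSeries (n + 1) else
            PowerSeries.mk fun m => (MvPowerSeries.X n : MvPowerSeries ℕ ℂ) ^ m))
        Fin.castSucc Fin.castSucc) =
        jacobiTrudi (hSeries (n + 1)) fun i : Fin n => (f i : ℤ) - (i : ℕ) := by
      rw [jacobiTrudi]
      congr 1
      ext1 i j
      simp
    rw [hminor, mul_comm _ (MvPowerSeries.X n ^ f n), ← mul_sub, pow_succ]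
    exact mul_dvd_mul_left _ (X_dvd_jacobiTrudi_hSeries_succ_sub n _)

end LeadingTerm

section FormalSums

open scoped MvPowerSeries.WithPiTopology

theorem continuous_of_continuous_coeff {X σ R : Type*} [Semiring R] [TopologicalSpace R]
    [TopologicalSpace X] {F : X → MvPowerSeries σ R}
    (h : ∀ d, Continuous fun x => MvPowerSeries.coeff d (F x)) : Continuous F :=
  continuous_pi h

theorem continuous_pderiv {σ R : Type*} [CommSemiring R] [TopologicalSpace R]
    [ContinuousMul R] (i : σ) : Continuous (MvPowerSeries.pderiv R i) := by
  refine continuous_of_continuous_coeff fun d => ?_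
  simp only [MvPowerSeries.coeff_pderiv]
  exact (MvPowerSeries.WithPiTopology.continuous_coeff R _).mul_const _

/-- The library's continuity of substitution is for discrete coefficients; here each coefficient of
the result is a finite linear combination of coefficients of the argument. -/
theorem continuous_subst {σ τ R S : Type*} [CommRing R] [CommRing S] [Algebra R S]
    [TopologicalSpace R] [TopologicalSpace S] [ContinuousAdd S] [ContinuousSMul R S]
    {a : σ → MvPowerSeries τ S} (ha : MvPowerSeries.HasSubst a) :
    Continuous (MvPowerSeries.subst a : MvPowerSeries σ R → MvPowerSeries τ S) := by
  refine continuous_of_continuous_coeff fun e => ?_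
  have hfin := MvPowerSeries.coeff_subst_finite ha (fun _ => 1 : MvPowerSeries σ R) e
  have hsum : ∀ f : MvPowerSeries σ R, MvPowerSeries.coeff e (MvPowerSeries.subst a f) =
      ∑ d ∈ hfin.toFinset,
        MvPowerSeries.coeff d f • MvPowerSeries.coeff e (d.prod fun s c => a s ^ c) := fun f => by
    rw [MvPowerSeries.coeff_subst ha]
    refine finsum_eq_sum_of_support_subset _ fun d hd => hfin.mem_toFinset.2 fun hzero => hd ?_
    change (1 : R) • MvPowerSeries.coeff e (d.prod fun s c => a s ^ c) = 0 at hzero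
    rw [one_smul] at hzero
    beta_reduce
    rw [hzero, smul_zero]
  simp only [hsum]
  exact continuous_finsetSum _ fun d _ =>
    (MvPowerSeries.WithPiTopology.continuous_coeff R d).smul continuous_const

section

variable {ι : Type*} {f : ι → MvPowerSeries ℕ+ ℂ} {F : MvPowerSeries ℕ+ ℂ}

theorem hasSum_dList (hf : HasSum f F) (I : List ℕ+) :
    HasSum (fun a => dList I (f a)) (dList I F) := by
  induction I with
  | nil => exact hf
  | cons i I ih => exact ih.map (MvPowerSeries.pderiv ℂ i) (continuous_pderiv i)

theorem hasSum_evalX (hf : HasSum f F) (k : ℕ) : HasSum (fun a => evalX k (f a)) (evalX k F) := by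
  have hcont : Continuous (MvPowerSeries.substAlgHom (R := ℂ) (hasSubst_xPoint k)) := by
    rw [MvPowerSeries.coe_substAlgHom]
    exact continuous_subst (hasSubst_xPoint k)
  have hsum := hf.map _ hcont
  rwa [MvPowerSeries.coe_substAlgHom] at hsum

end

theorem X_pow_dvd_of_hasSum {ι σ R : Type*} [CommSemiring R] [TopologicalSpace R] [T2Space R]
    {i : σ} {n : ℕ} {f : ι → MvPowerSeries σ R} {F : MvPowerSeries σ R} (hf : HasSum f F)
    (h : ∀ a, MvPowerSeries.X i ^ n ∣ f a) : MvPowerSeries.X i ^ n ∣ F := by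
  refine MvPowerSeries.X_pow_dvd_iff.2 fun d hd => ?_
  have hcoeff := hf.map (MvPowerSeries.coeff d) (MvPowerSeries.WithPiTopology.continuous_coeff R d)
  refine hcoeff.unique ?_
  convert hasSum_zero using 1
  exact funext fun a => MvPowerSeries.X_pow_dvd_iff.1 (h a) d hd

open Classical in
theorem hasSum_formalSum {P : YoungDiagram → Prop} (ξ : YoungDiagram → ℂ)
    {s : YoungDiagram → MvPolynomial ℕ+ ℂ}
    (hs : ∀ d, {μ | P μ ∧ MvPolynomial.coeff d (s μ) ≠ 0}.Finite) :
    HasSum (fun μ => if P μ then ξ μ • (s μ : MvPowerSeries ℕ+ ℂ) else 0) (formalSum P ξ s) := by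
  refine MvPowerSeries.WithPiTopology.hasSum_iff_hasSum_coeff.2 fun d => ?_
  have hfin : (fun μ => MvPowerSeries.coeff d
      (if P μ then ξ μ • (s μ : MvPowerSeries ℕ+ ℂ) else 0)).HasFiniteSupport := by
    refine (hs d).subset fun μ hμ => ?_
    have hP : P μ := by_contra fun h => hμ (by simp [h])
    exact ⟨hP, fun hzero => hμ (by simp [hP, hzero])⟩
  have hcoeff : MvPowerSeries.coeff d (formalSum P ξ s) = ∑ᶠ μ,
      MvPowerSeries.coeff d (if P μ then ξ μ • (s μ : MvPowerSeries ℕ+ ℂ) else 0) := by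
    refine finsum_congr fun μ => ?_
    rw [finsum_eq_if]
    split_ifs <;> simp
  rw [hcoeff, ← tsum_eq_finsum (L := .unconditional _) hfin]
  exact (summable_of_hasFiniteSupport hfin).hasSum

end FormalSums

section Tau

open scoped MvPowerSeries.WithPiTopology

open Classical in
/-- The coefficient of `s_μ` in `τ`. -/
def tauCoeff (B : Finset ℕ) (ξ : YoungDiagram → ℂ) (μ : YoungDiagram) : ℂ :=
  if μ = lam B then 1 else if lam B < μ then ξ μ else 0

variable {B : Finset ℕ} (ξ : YoungDiagram → ℂ) {k : ℕ}

theorem tauCoeff_eq_zero {μ : YoungDiagram} (h : ¬lam B ≤ μ) : tauCoeff B ξ μ = 0 := by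
  rw [tauCoeff, if_neg fun heq => h heq.ge, if_neg fun hlt => h hlt.le]

theorem hasSum_tau :
    HasSum (fun μ => tauCoeff B ξ μ • (schur μ : MvPowerSeries ℕ+ ℂ)) (tau B ξ) := by
  classical
  convert (hasSum_ite_eq (lam B) (schur (lam B) : MvPowerSeries ℕ+ ℂ)).add
    (hasSum_formalSum (P := (lam B < ·)) ξ fun d =>
      (schur_coeff_finite d).subset fun μ h => h.2) using 2 with μ
  · rw [tauCoeff]
    split_ifs <;> simp_all
  · rfl

theorem sameTail_lam (B : Finset ℕ) (k : ℕ) : SameTail B k (lam B) :=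
  ⟨colLen_zero_lam_le B, fun _ _ _ => rfl⟩

open Classical in
theorem hasSum_tauTrunc :
    HasSum (fun μ => if SameTail B k μ then
      tauCoeff B ξ μ • (schurSeq k μ.rowLen : MvPowerSeries ℕ+ ℂ) else 0) (tauTrunc B ξ k) := by
  convert (hasSum_ite_eq (lam B) (schurSeq k (lam B).rowLen : MvPowerSeries ℕ+ ℂ)).add
    (hasSum_formalSum (P := fun μ => lam B < μ ∧ SameTail B k μ) ξ fun d =>
      (schurSeq_coeff_finite B k d).subset fun μ h => ⟨h.1.2, h.2⟩) using 2 with μ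
  · have := sameTail_lam B k
    rw [tauCoeff]
    split_ifs <;> simp_all
  · rfl

theorem dList_smul (I : List ℕ+) (c : ℂ) (f : MvPowerSeries ℕ+ ℂ) :
    dList I (c • f) = c • dList I f := by
  induction I with
  | nil => rfl
  | cons i I ih => exact (congrArg (MvPowerSeries.pderiv ℂ i) ih).trans (Derivation.map_smul _ _ _)

theorem evalX_smul (k : ℕ) (c : ℂ) (f : MvPowerSeries ℕ+ ℂ) : evalX k (c • f) = c • evalX k f := by
  rw [evalX, ← MvPowerSeries.substAlgHom_apply (hasSubst_xPoint k), map_smul,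
    MvPowerSeries.substAlgHom_apply, evalX]

theorem evalX_zero (k : ℕ) : evalX k 0 = 0 := by
  simpa using evalX_smul k 0 0

theorem hasSum_evalX_dList_tau (k : ℕ) (I : List ℕ+) :
    HasSum (fun μ => tauCoeff B ξ μ • evalX k (dList I (schur μ : MvPowerSeries ℕ+ ℂ)))
      (evalX k (dList I (tau B ξ))) := by
  simpa only [dList_smul, evalX_smul] using hasSum_evalX (hasSum_dList (hasSum_tau ξ) I) k

open Classical in
theorem hasSum_evalX_tauTrunc (k : ℕ) :
    HasSum (fun μ => if SameTail B k μ then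
      tauCoeff B ξ μ • evalX k (schurSeq k μ.rowLen : MvPowerSeries ℕ+ ℂ) else 0)
      (evalX k (tauTrunc B ξ k)) := by
  simpa only [apply_ite (evalX k), evalX_smul, evalX_zero] using
    hasSum_evalX (hasSum_tauTrunc (k := k) ξ) k

theorem evalX_dList_tau (hk : k ≤ B.card) :
    evalX k (dList (aSeq B k) (tau B ξ)) =
      (((cSign B k : ℤˣ) : ℤ) : ℂ) • evalX k (tauTrunc B ξ k) := by
  classical
  refine (hasSum_evalX_dList_tau ξ k (aSeq B k)).unique ?_
  convert (hasSum_evalX_tauTrunc ξ k).const_smul (((cSign B k : ℤˣ) : ℤ) : ℂ) using 2 with μ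
  by_cases hμ : lam B ≤ μ
  · split_ifs with hs
    · rw [evalX_dList_schur_of_sameTail hs hk hμ, smul_comm]
    · rw [evalX_dList_schur_of_not_sameTail hk hμ hs, smul_zero, smul_zero]
  · simp [tauCoeff_eq_zero ξ hμ]

theorem evalX_dList_tau_eq_zero {I : List ℕ+}
    (h : ∀ μ, lam B ≤ μ → evalX k (dList I (schur μ : MvPowerSeries ℕ+ ℂ)) = 0) :
    evalX k (dList I (tau B ξ)) = 0 := by
  refine (hasSum_evalX_dList_tau ξ k I).unique ?_
  convert hasSum_zero using 2 with μ
  by_cases hμ : lam B ≤ μ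
  · rw [h μ hμ, smul_zero]
  · rw [tauCoeff_eq_zero ξ hμ, zero_smul]

section Truncation

variable {n : ℕ}

theorem sameTail_iff_succ (hn : n < B.card) {μ : YoungDiagram} :
    SameTail B n μ ↔ SameTail B (n + 1) μ ∧ μ.rowLen n = (lam B).rowLen n := by
  refine ⟨fun h => ⟨⟨h.1, fun i hi => h.2 i (by omega)⟩, h.2 n le_rfl hn⟩,
    fun h => ⟨h.1.1, fun i hi hi' => ?_⟩⟩
  rcases hi.eq_or_lt with rfl | hlt
  · exact h.2
  · exact h.1.2 i hlt hi'

theorem X_pow_dvd_evalX_schurSeq_succ {f : ℕ → ℕ} (hf : Antitone f) :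
    (MvPowerSeries.X n : MvPowerSeries ℕ ℂ) ^ f n ∣
      evalX (n + 1) (schurSeq (n + 1) f : MvPowerSeries ℕ+ ℂ) := by
  rw [← dvd_sub_left (Dvd.intro_left _ rfl)]
  exact (pow_dvd_pow _ (Nat.le_succ _)).trans (X_pow_dvd_evalX_schurSeq_succ_sub n hf)

theorem eqModX_evalX_tauTrunc_succ (hn : n < B.card) :
    EqModX (n + 1) ((lam B).rowLen n + 1) (evalX (n + 1) (tauTrunc B ξ (n + 1)))
      (evalX n (tauTrunc B ξ n) * MvPowerSeries.X n ^ (lam B).rowLen n) := by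
  classical
  refine X_pow_dvd_of_hasSum ((hasSum_evalX_tauTrunc ξ (n + 1)).sub
    ((hasSum_evalX_tauTrunc ξ n).mul_right _)) fun μ => ?_
  rw [Nat.add_sub_cancel]
  by_cases hμ : lam B ≤ μ
  · by_cases hs : SameTail B (n + 1) μ
    · rcases (rowLen_mono hμ n).eq_or_lt with hrow | hrow
      · rw [if_pos hs, if_pos ((sameTail_iff_succ hn).2 ⟨hs, hrow.symm⟩), smul_mul_assoc,
          ← smul_sub, hrow]
        exact dvd_smul_of_dvd _ (X_pow_dvd_evalX_schurSeq_succ_sub n μ.rowLen_anti)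
      · rw [if_pos hs, if_neg fun h => hrow.ne' ((sameTail_iff_succ hn).1 h).2, zero_mul, sub_zero]
        exact dvd_smul_of_dvd _ ((pow_dvd_pow _ hrow).trans
          (X_pow_dvd_evalX_schurSeq_succ μ.rowLen_anti))
    · rw [if_neg hs, if_neg fun h => hs ((sameTail_iff_succ hn).1 h).1, zero_mul, sub_zero]
      exact dvd_zero _
  · simp [tauCoeff_eq_zero ξ hμ]

theorem eqModX_evalX_dList_tau_succ (hn : n < B.card) :
    EqModX (n + 1) ((lam B).rowLen n + 1) (evalX (n + 1) (dList (aSeq B (n + 1)) (tau B ξ)))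
      (((((cSign B (n + 1) : ℤˣ) : ℤ) : ℂ) / (((cSign B n : ℤˣ) : ℤ) : ℂ)) •
        (evalX n (dList (aSeq B n) (tau B ξ)) * MvPowerSeries.X n ^ (lam B).rowLen n)) := by
  rw [evalX_dList_tau ξ hn, evalX_dList_tau ξ hn.le, smul_mul_assoc, smul_smul,
    div_mul_cancel₀ _ (by simp), EqModX, ← smul_sub]
  exact dvd_smul_of_dvd _ (eqModX_evalX_tauTrunc_succ ξ hn)

theorem eq_lam_of_sameTail_zero {μ : YoungDiagram} (h : SameTail B 0 μ) : μ = lam B := by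
  ext ⟨i, j⟩
  rw [YoungDiagram.mem_cells, YoungDiagram.mem_cells, YoungDiagram.mem_iff_lt_rowLen,
    YoungDiagram.mem_iff_lt_rowLen]
  rcases lt_or_ge i B.card with hi | hi
  · rw [h.2 i (Nat.zero_le i) hi]
  · rw [rowLen_eq_zero (h.1.trans hi), rowLen_eq_zero ((colLen_zero_lam_le B).trans hi)]

theorem tauTrunc_zero (B : Finset ℕ) : tauTrunc B ξ 0 = 1 := by
  refine (hasSum_tauTrunc ξ).unique ?_
  convert hasSum_single (lam B) fun μ hμ => if_neg fun hs => hμ (eq_lam_of_sameTail_zero hs)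
  simp [sameTail_lam, tauCoeff, schurSeq]

end Truncation

section ConstantTerm

theorem constantCoeff_evalX_zero (f : MvPowerSeries ℕ+ ℂ) :
    MvPowerSeries.constantCoeff (evalX 0 f) = MvPowerSeries.constantCoeff f := by
  rw [evalX, MvPowerSeries.constantCoeff_subst (hasSubst_xPoint 0), finsum_eq_single _ 0]
  · simp
  · intro d hd
    obtain ⟨i, hi⟩ := Finsupp.ne_iff.1 hd
    rw [Finsupp.prod, Finset.prod_eq_zero (Finsupp.mem_support_iff.2 hi), map_zero, smul_zero]
    rw [xPoint, Finset.range_zero, Finset.sum_empty]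
    exact zero_pow hi

theorem constantCoeff_dList_tau_eq_zero_of_sum_lt {I : List ℕ+}
    (hI : (I.map fun i : ℕ+ => (i : ℕ)).sum < (lam B).card) :
    MvPowerSeries.constantCoeff (dList I (tau B ξ)) = 0 := by
  rw [← constantCoeff_evalX_zero, evalX_dList_tau_eq_zero ξ fun μ hμ =>
    evalX_zero_dList_schur_of_sum_lt_card (hI.trans_le (Finset.card_le_card hμ)), map_zero]

theorem constantCoeff_dList_tau_eq_zero_of_length_lt {I : List ℕ+} (hI : I.length < mNum B 0) :
    MvPowerSeries.constantCoeff (dList I (tau B ξ)) = 0 := by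
  rw [← constantCoeff_evalX_zero, evalX_dList_tau_eq_zero ξ fun μ hμ =>
    evalX_zero_dList_schur_of_length_mem (hμ (length_mem_lam hI)), map_zero]

theorem constantCoeff_dList_tau (B : Finset ℕ) :
    MvPowerSeries.constantCoeff (dList (aSeq B 0) (tau B ξ)) =
      (((cSign B 0 : ℤˣ) : ℤ) : ℂ) := by
  rw [← constantCoeff_evalX_zero, evalX_dList_tau ξ (Nat.zero_le _),
    MvPowerSeries.constantCoeff_smul, constantCoeff_evalX_zero, tauTrunc_zero, map_one,
    smul_eq_mul, mul_one]

end ConstantTerm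

end Tau

end

end GapTau

theorem mainTheorem9 (B : Finset ℕ) (ξ : YoungDiagram → ℂ) :
    (∀ k : ℕ, k < B.card → 0 < GapTau.mNum B k →
      GapTau.evalX k (GapTau.dList (GapTau.aSeq B k) (GapTau.tau B ξ)) =
        (((GapTau.cSign B k : ℤˣ) : ℤ) : ℂ) • GapTau.evalX k (GapTau.tauTrunc B ξ k)) ∧
    (∀ k : ℕ, 1 ≤ k → k < B.card → 0 < GapTau.mNum B k →
      GapTau.EqModX k ((GapTau.lam B).rowLen (k - 1) + 1)
        (GapTau.evalX k (GapTau.tauTrunc B ξ k))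
        (GapTau.evalX (k - 1) (GapTau.tauTrunc B ξ (k - 1)) *
          MvPowerSeries.X (k - 1) ^ (GapTau.lam B).rowLen (k - 1))) ∧
    (∀ k : ℕ, 1 ≤ k → k < B.card → 0 < GapTau.mNum B k →
      GapTau.EqModX k ((GapTau.lam B).rowLen (k - 1) + 1)
        (GapTau.evalX k (GapTau.dList (GapTau.aSeq B k) (GapTau.tau B ξ)))
        (((((GapTau.cSign B k : ℤˣ) : ℤ) : ℂ) / (((GapTau.cSign B (k - 1) : ℤˣ) : ℤ) : ℂ)) •
          (GapTau.evalX (k - 1) (GapTau.dList (GapTau.aSeq B (k - 1)) (GapTau.tau B ξ)) *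
            MvPowerSeries.X (k - 1) ^ (GapTau.lam B).rowLen (k - 1)))) ∧
    (∀ I : List ℕ+, (I.map fun i : ℕ+ => (i : ℕ)).sum < (GapTau.lam B).card →
      MvPowerSeries.constantCoeff (GapTau.dList I (GapTau.tau B ξ)) = 0) ∧
    (∀ I : List ℕ+, I.length < GapTau.mNum B 0 →
      MvPowerSeries.constantCoeff (GapTau.dList I (GapTau.tau B ξ)) = 0) ∧
    MvPowerSeries.constantCoeff (GapTau.dList (GapTau.aSeq B 0) (GapTau.tau B ξ)) =
      (((GapTau.cSign B 0 : ℤˣ) : ℤ) : ℂ) := by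
  refine ⟨fun k hk _ => GapTau.evalX_dList_tau ξ hk.le, fun k h1 hk _ => ?_, fun k h1 hk _ => ?_,
    fun I hI => GapTau.constantCoeff_dList_tau_eq_zero_of_sum_lt ξ hI,
    fun I hI => GapTau.constantCoeff_dList_tau_eq_zero_of_length_lt ξ hI,
    GapTau.constantCoeff_dList_tau ξ B⟩
  · obtain ⟨n, rfl⟩ := Nat.exists_eq_add_of_le' h1
    exact GapTau.eqModX_evalX_tauTrunc_succ ξ (Nat.lt_of_succ_lt hk)
  · obtain ⟨n, rfl⟩ := Nat.exists_eq_add_of_le' h1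
    exact GapTau.eqModX_evalX_dList_tau_succ ξ (Nat.lt_of_succ_lt hk)
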